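/- Let $\mathbb{N}=\{1,2,\dots\}$, and let $\mathbb{N}^*=\mathbb{N}\cup\{\infty\}$ carry the metric $d(i,j)=\sum_{k=i}^{j-1}2^{-k}$ for $1\le i<j\le\infty$ (so $\mathbb{N}^*$ is the one-point compactification of the discrete space $\mathbb{N}$). Let $S(\mathbb{N},\mathbb{N}^*)$ be the set of functions $\sigma=(\sigma_i)_{i\ge1}$ from $\mathbb{N}$ to $\mathbb{N}^*$ such that $\sigma_i=\sigma_j$ with $i\ne j$ only if $\sigma_i=\infty$, with the topology of pointwise convergence. Let $S(\mathbb{N},\mathbb{N})\subset S(\mathbb{N},\mathbb{N}^*)$ be the set of injections from $\mathbb{N}$ to $\mathbb{N}$ and $S_\infty\subset S(\mathbb{N},\mathbb{N})$ the set of bijections from $\mathbb{N}$ to $\mathbb{N}$. A permutation $\sigma$ of $[n]=\{1,\dots,n\}$ is regarded as an element of $S_\infty$ by setting $\sigma_j=j$ for $j>n$. A finite word of distinct positive integers is $312$-avoiding if it has no three letters $w_i,w_j,w_k$ with $i<j<k$ and $w_j<w_k<w_i$. Let $\mu_n$ be the uniform probability measure on the $312$-avoiding permutations of $[n]$, considered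 as a probability measure on $S(\mathbb{N},\mathbb{N}^*)$. For a finite block $I\subset\mathbb{N}$ of consecutive integers (possibly empty), a permutation image of $I$ is a word in which every element of $I$ occurs exactly once and no other letter occurs. Let $(X_n)_{n\ge1}$, $(Y_n)_{n\ge1}$ and $(\Pi_I)_I$, with $I$ ranging over the finite blocks, be mutually independent random variables (all variables in all three families together), where $$P(X_n=k)=\frac{C_k}{2\cdot4^k},\quad k=0,1,2,\dots,\qquad P(Y_n=k)=\Big(\frac12\Big)^k,\quad k=1,2,\dots,$$ $C_k$ is the $k$-th Catalan number, and $\Pi_I$ is uniformly distributed over the $312$-avoiding permutation images of $I$. Put $T_n^X=\sum_{j=1}^nX_j$ and $T_n^Y=\sum_{j=1}^nY_j$, with $T^X_0=T^Y_0=0$. Write $*$ for concatenation of words, and $[a,b]=\{a,\dots,b\}$, which is empty if $b<a$. Theorem. Such random variables exist on some probability space, and as $n\to\infty$ the measures $\mu_n$ converge weakly on $S(\mathbb{N},\mathbb{N}^*)$ to the distribution of the random variable $$\Pi_{[T_1^Y+1,\,T_1^Y+T_1^X]}*(T_1^Y)*\Pi_{[T_2^Y+T_1^X+1,\,T_2^Y+T_2^X]}*(T_2^Y+T_1^X)*\cdots,$$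 whose $n$-th segment is $\Pi_{[T_n^Y+T_{n-1}^X+1,\,T_n^Y+T_n^X]}*(T_n^Y+T_{n-1}^X)$, $n\ge1$. Almost surely, this random variable belongs to $S(\mathbb{N},\mathbb{N})\setminus S_\infty$; that is, the limiting distribution is supported on the injections from $\mathbb{N}$ to $\mathbb{N}$ that are not surjective onto $\mathbb{N}$. -/

import Mathlib

open Filter Topology MeasureTheory ProbabilityTheory

/-! ### The space of generalised injections

Here `ℕ+` is the set `{1, 2, …}` and `OnePoint ℕ+` is `{1, 2, …} ∪ {∞}`, the one-point
compactification of the discrete space `ℕ+`. Its topology is the one given by the metric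
`d(i, j) = ∑_{i ≤ k < j} 2^{-k}`, and the product topology on sequences is the one given by
`∑ i, d(σ i, τ i) / 2^i`. -/

/-- Functions `σ` from the positive integers to the positive integers with `∞` adjoined that take
each finite value at most once. -/
def GenInj : Type :=
  {σ : ℕ+ → OnePoint ℕ+ // ∀ i j, i ≠ j → σ i = σ j → σ i = OnePoint.infty}

namespace GenInj

instance : CoeFun GenInj (fun _ => ℕ+ → OnePoint ℕ+) := ⟨fun σ => σ.1⟩

/-- The topology of pointwise convergence in `OnePoint ℕ+`. -/
instance : TopologicalSpace GenInj :=
  inferInstanceAs (TopologicalSpace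
    {σ : ℕ+ → OnePoint ℕ+ // ∀ i j, i ≠ j → σ i = σ j → σ i = OnePoint.infty})

instance : MeasurableSpace GenInj := borel GenInj

instance : BorelSpace GenInj := ⟨rfl⟩

/-- An injection of the positive integers into themselves, as a point of `GenInj`. -/
def ofInjective (f : ℕ+ → ℕ+) (hf : Function.Injective f) : GenInj :=
  ⟨fun i => (f i : OnePoint ℕ+), fun _ _ hij h => absurd (hf (OnePoint.coe_injective h)) hij⟩

/-- The injections of the positive integers into themselves: no value is `∞`. -/
def injections : Set GenInj := {σ | ∀ i, σ i ≠ OnePoint.infty}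

/-- The permutations of the positive integers: injections all of whose values are finite and that
take every finite value. -/
def permutations : Set GenInj := {σ | σ ∈ injections ∧ ∀ k : ℕ+, ∃ i, σ i = (k : OnePoint ℕ+)}

end GenInj

/-! ### Pattern avoidance -/

/-- The word `w` has a subword whose entries are in the same relative order as those of `p`. -/
def ContainsPattern {k m : ℕ} {α : Type*} [LT α] (p : Fin k → ℕ) (w : Fin m → α) : Prop :=
  ∃ e : Fin k ↪o Fin m, ∀ a b, w (e a) < w (e b) ↔ p a < p b

/-- The pattern `312`. -/
def pattern312 : Fin 3 → ℕ := ![3, 1, 2]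

/-- The word `w` avoids the pattern `312`. -/
def Avoids312 {m : ℕ} {α : Type*} [LT α] (w : Fin m → α) : Prop := ¬ ContainsPattern pattern312 w

theorem avoids312_of_monotone {m : ℕ} {α : Type*} [Preorder α] {w : Fin m → α}
    (hw : Monotone w) : Avoids312 w := by
  rintro ⟨e, he⟩
  have h1 : w (e 1) < w (e 0) := (he 1 0).2 (by simp [pattern312])
  exact absurd (hw (e.monotone (by decide : (0 : Fin 3) ≤ 1))) (not_le_of_gt h1)

/-! ### The uniform measures on `312`-avoiding permutations -/

/-- The `312`-avoiding permutations of `n` ordered letters. -/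
abbrev AvoidingPerm (n : ℕ) : Type := {π : Equiv.Perm (Fin n) // Avoids312 (fun i => π i)}

noncomputable instance (n : ℕ) : Fintype (AvoidingPerm n) := Fintype.ofFinite _

instance (n : ℕ) : Nonempty (AvoidingPerm n) :=
  ⟨⟨Equiv.refl _, avoids312_of_monotone fun _ _ h => h⟩⟩

/-- A permutation of `{1, …, n}` (with `i : Fin n` standing for the letter `i + 1`) extended by the
identity to all positive integers. -/
def extendPerm {n : ℕ} (π : Equiv.Perm (Fin n)) (j : ℕ+) : ℕ+ :=
  if h : (j : ℕ) - 1 < n then Nat.succPNat (π ⟨(j : ℕ) - 1, h⟩) else j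

theorem extendPerm_injective {n : ℕ} (π : Equiv.Perm (Fin n)) :
    Function.Injective (extendPerm π) := by
  intro i j hij
  have hi := i.pos
  have hj := j.pos
  have h := congrArg (fun k : ℕ+ => (k : ℕ)) hij
  simp only [extendPerm] at h
  apply PNat.coe_injective
  split_ifs at h with h1 h2 h2
  · have h3 := π.injective (Fin.ext (by simpa using h))
    simp only [Fin.mk.injEq] at h3
    omega
  · have := (π ⟨(i : ℕ) - 1, h1⟩).isLt
    simp only [Nat.succPNat_coe] at h
    omega
  · have := (π ⟨(j : ℕ) - 1, h2⟩).isLt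
    simp only [Nat.succPNat_coe] at h
    omega
  · exact h

/-- A permutation of `{1, …, n}` as a point of `GenInj`. -/
def embedPerm {n : ℕ} (π : Equiv.Perm (Fin n)) : GenInj :=
  GenInj.ofInjective (extendPerm π) (extendPerm_injective π)

/-- The uniform probability measure on the `312`-avoiding permutations of `{1, …, n}`, as a
probability measure on `GenInj`. -/
noncomputable def mu312 (n : ℕ) : ProbabilityMeasure GenInj :=
  ⟨((PMF.uniformOfFintype (AvoidingPerm n)).map fun π => embedPerm π.1).toMeasure, inferInstance⟩

/-! ### Permutation images of blocks -/

/-- Finite blocks of consecutive positive integers, the empty one included. -/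
abbrev Block : Type := {I : Finset ℕ+ // ∃ a b : ℕ+, I = Finset.Icc a b}

/-- The `312`-avoiding permutation images of the block `I`: words in which every element of `I`
occurs exactly once and nothing else occurs. -/
abbrev AvoidingImage (I : Block) : Type :=
  {l : List ℕ+ // l.Nodup ∧ (∀ k, k ∈ l ↔ k ∈ I.1) ∧ Avoids312 l.get}

/-! ### Infinite concatenation -/

theorem le_length_flatMap_range {α : Type*} (u : ℕ → List α) (hu : ∀ n, u n ≠ []) (N : ℕ) :
    N ≤ ((List.range N).flatMap u).length := by
  induction N with
  | zero => simp
  | succ N ih =>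
    have := List.length_pos_of_ne_nil (hu N)
    simp only [List.range_succ, List.flatMap_append, List.flatMap_singleton, List.length_append]
    omega

/-- The infinite word `u 0 * u 1 * u 2 * ⋯` for nonempty words `u n`, with positions numbered from
`1`: its `i`-th letter lies in the first `i` words. -/
def concat {α : Type*} (u : ℕ → List α) (hu : ∀ n, u n ≠ []) (i : ℕ+) : α :=
  ((List.range i).flatMap u)[(i : ℕ) - 1]'(by
    have := le_length_flatMap_range u hu i
    have := i.pos
    omega)

theorem concat_injective {α : Type*} (u : ℕ → List α) (hu : ∀ n, u n ≠ [])
    (hnd : ∀ n, (u n).Nodup) (hdis : ∀ m n, m < n → List.Disjoint (u m) (u n)) :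
    Function.Injective (concat u hu) := by
  have hN : ∀ N, ((List.range N).flatMap u).Nodup := by
    intro N
    rw [List.nodup_flatMap]
    refine ⟨fun n _ => hnd n, ?_⟩
    exact List.pairwise_lt_range.imp fun {m n} h => hdis m n h
  have key : ∀ (i : ℕ+) (M : ℕ), (i : ℕ) ≤ M →
      ((List.range M).flatMap u)[(i : ℕ) - 1]? = some (concat u hu i) := by
    intro i M hM
    obtain ⟨d, rfl⟩ := Nat.exists_eq_add_of_le hM
    have h1 := le_length_flatMap_range u hu i
    have h2 := i.pos
    rw [List.range_add, List.flatMap_append, List.getElem?_append_left (by omega),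
      List.getElem?_eq_getElem (by omega)]
    rfl
  intro i j hij
  have hi := key i (max i j) (le_max_left _ _)
  have hj := key j (max i j) (le_max_right _ _)
  have h1 := le_length_flatMap_range u hu (max i j)
  have h2 := i.pos
  have h3 := j.pos
  have h4 : (i : ℕ) - 1 = (j : ℕ) - 1 := by
    refine (List.getElem?_inj (l := (List.range (max (i : ℕ) j)).flatMap u) ?_ (hN _)).1 ?_
    · omega
    · rw [hi, hj, hij]
  apply PNat.coe_injective
  omega

/-! ### The regenerative random injection

Sequences indexed from `1` in the mathematical text are indexed from `0` here: `x n` and `y n` are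
the `(n + 1)`-st terms. -/

/-- Partial sums: the sum of the first `n` terms. -/
def partialSum (x : ℕ → ℕ) (n : ℕ) : ℕ := ∑ j ∈ Finset.range n, x j

theorem partialSum_succ (x : ℕ → ℕ) (n : ℕ) : partialSum x (n + 1) = partialSum x n + x n :=
  Finset.sum_range_succ _ _

theorem partialSum_mono (x : ℕ → ℕ) : Monotone (partialSum x) :=
  monotone_nat_of_le_succ fun n => by rw [partialSum_succ]; omega

/-- `T^Y`: the partial sums of a sequence of positive integers. -/
def sumY (y : ℕ → ℕ+) (n : ℕ) : ℕ := partialSum (fun j => (y j : ℕ)) n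

theorem sumY_succ (y : ℕ → ℕ+) (n : ℕ) : sumY y (n + 1) = sumY y n + y n := partialSum_succ _ _

theorem sumY_succ_pos (y : ℕ → ℕ+) (n : ℕ) : 0 < sumY y (n + 1) := by
  have := (y n).pos
  rw [sumY_succ]; omega

/-- The `(n + 1)`-st singleton `T^Y_{n+1} + T^X_n`. -/
def singletonValue (x : ℕ → ℕ) (y : ℕ → ℕ+) (n : ℕ) : ℕ+ :=
  ⟨sumY y (n + 1) + partialSum x n, Nat.add_pos_left (sumY_succ_pos y n) _⟩

/-- The right end point `T^Y_{n+1} + T^X_{n+1}` of the `(n + 1)`-st block. -/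
def blockEnd (x : ℕ → ℕ) (y : ℕ → ℕ+) (n : ℕ) : ℕ+ :=
  ⟨sumY y (n + 1) + partialSum x (n + 1), Nat.add_pos_left (sumY_succ_pos y n) _⟩

theorem coe_singletonValue (x : ℕ → ℕ) (y : ℕ → ℕ+) (n : ℕ) :
    (singletonValue x y n : ℕ) = sumY y (n + 1) + partialSum x n := rfl

theorem coe_blockEnd (x : ℕ → ℕ) (y : ℕ → ℕ+) (n : ℕ) :
    (blockEnd x y n : ℕ) = sumY y (n + 1) + partialSum x (n + 1) := rfl

/-- The `(n + 1)`-st block `[T^Y_{n+1} + T^X_n + 1, T^Y_{n+1} + T^X_{n+1}]`; it has `x n` elements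
and is empty if `x n = 0`. -/
def regBlock (x : ℕ → ℕ) (y : ℕ → ℕ+) (n : ℕ) : Block :=
  ⟨Finset.Icc (singletonValue x y n + 1) (blockEnd x y n), _, _, rfl⟩

theorem mem_regBlock {x : ℕ → ℕ} {y : ℕ → ℕ+} {n : ℕ} {k : ℕ+} (h : k ∈ (regBlock x y n).1) :
    (singletonValue x y n : ℕ) < k ∧ (k : ℕ) ≤ blockEnd x y n := by
  have h := Finset.mem_Icc.1 (show k ∈ Finset.Icc _ _ from h)
  exact ⟨h.1, h.2⟩

/-- The `(n + 1)`-st segment: the permutation image of the `(n + 1)`-st block, followed by the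
`(n + 1)`-st singleton. -/
def regSegment (x : ℕ → ℕ) (y : ℕ → ℕ+) (w : (I : Block) → AvoidingImage I) (n : ℕ) : List ℕ+ :=
  (w (regBlock x y n)).1 ++ [singletonValue x y n]

theorem regSegment_ne_nil (x : ℕ → ℕ) (y : ℕ → ℕ+) (w : (I : Block) → AvoidingImage I) (n : ℕ) :
    regSegment x y w n ≠ [] := by simp [regSegment]

theorem mem_regSegment {x : ℕ → ℕ} {y : ℕ → ℕ+} {w : (I : Block) → AvoidingImage I} {n : ℕ} {k : ℕ+}
    (h : k ∈ regSegment x y w n) :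
    sumY y (n + 1) + partialSum x n ≤ k ∧ (k : ℕ) ≤ sumY y (n + 1) + partialSum x (n + 1) := by
  rcases List.mem_append.1 h with h | h
  · have h := mem_regBlock (((w (regBlock x y n)).2.2.1 k).1 h)
    rw [coe_singletonValue, coe_blockEnd] at h
    omega
  · rw [List.mem_singleton] at h
    subst h
    rw [coe_singletonValue, partialSum_succ]
    omega

theorem regSegment_nodup (x : ℕ → ℕ) (y : ℕ → ℕ+) (w : (I : Block) → AvoidingImage I) (n : ℕ) :
    (regSegment x y w n).Nodup := by
  refine List.Nodup.append (w _).2.1 (List.nodup_singleton _) ?_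
  intro k hk hk'
  rw [List.mem_singleton] at hk'
  subst hk'
  exact absurd (mem_regBlock (((w (regBlock x y n)).2.2.1 _).1 hk)).1 (lt_irrefl _)

theorem regSegment_disjoint (x : ℕ → ℕ) (y : ℕ → ℕ+) (w : (I : Block) → AvoidingImage I) (m n : ℕ)
    (h : m < n) : List.Disjoint (regSegment x y w m) (regSegment x y w n) := by
  intro k hm hn
  have hm := (mem_regSegment hm).2
  have hn := (mem_regSegment hn).1
  have h1 : partialSum x (m + 1) ≤ partialSum x n := partialSum_mono x h
  have h2 : sumY y (m + 1) ≤ sumY y n := partialSum_mono _ h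
  have := (y n).pos
  rw [sumY_succ y n] at hn
  omega

/-- The concatenation of all segments, as a point of `GenInj`. -/
def regInjection (x : ℕ → ℕ) (y : ℕ → ℕ+) (w : (I : Block) → AvoidingImage I) : GenInj :=
  GenInj.ofInjective (concat (regSegment x y w) (regSegment_ne_nil x y w))
    (concat_injective _ _ (regSegment_nodup x y w) (regSegment_disjoint x y w))

/-- Labels of the random variables `X_{n+1}`, `Y_{n+1}` and `Π_I`. -/
inductive RVIndex : Type
  | X (n : ℕ)
  | Y (n : ℕ)
  | image (I : Block)

/-- The countable discrete set in which the random variable with a given label takes its values. -/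
def RVIndex.Value : RVIndex → Type
  | X _ => ℕ
  | Y _ => ℕ+
  | image I => AvoidingImage I

instance (i : RVIndex) : MeasurableSpace i.Value := ⊤

/-- Three families of functions on `Ω` as a single family. -/
def allRV {Ω : Type*} (X : ℕ → Ω → ℕ) (Y : ℕ → Ω → ℕ+) (W : (I : Block) → Ω → AvoidingImage I) :
    (i : RVIndex) → Ω → i.Value
  | .X n => X n
  | .Y n => Y n
  | .image I => W I

/-- `X n`, `Y n`, `W I` are mutually independent random variables on `(Ω, P)`, with
`P (X n = k) = C_k / (2 * 4 ^ k)` for `k = 0, 1, …`, `P (Y n = k) = (1 / 2) ^ k` for `k = 1, 2, …`,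
and `W I` uniformly distributed over the `312`-avoiding permutation images of the block `I`. -/
structure IsRegenerativeFamily {Ω : Type*} [MeasurableSpace Ω] (P : Measure Ω)
    (X : ℕ → Ω → ℕ) (Y : ℕ → Ω → ℕ+) (W : (I : Block) → Ω → AvoidingImage I) : Prop where
  measurable : ∀ i, Measurable (allRV X Y W i)
  indep : iIndepFun (allRV X Y W) P
  law_X : ∀ n k, P.real {ω | X n ω = k} = (catalan k : ℝ) / (2 * 4 ^ k)
  law_Y : ∀ n k, P.real {ω | Y n ω = k} = (1 / 2 : ℝ) ^ (k : ℕ)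
  law_W : ∀ I l, P.real {ω | W I ω = l} = 1 / (Nat.card (AvoidingImage I) : ℝ)

/-! ### Words avoiding `312` -/

/-! Cut a word avoiding `312` at its smallest letter. Every letter before the cut is smaller than
every letter after it, so both halves are again such words on intervals. Hence these words are coded
by binary trees (`treeWord`, `exists_treeWord_eq`), and a uniform permutation becomes a uniform
tree.

Walk down a large tree, always into the larger subtree. When the walk goes left, the letter of the
vertex is postponed behind the whole word of a large subtree, so in the limit it is lost. When it
goes right, the word of the small left subtree and the letter of the vertex are written out. A
stretch of left steps closed by a right step thus writes one segment of the limit: `Y` is the number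
of left steps plus one, `X` is the size of the small left subtree, and that subtree is uniform given
its size. As `C_{n-j} / C_n → 4^{-j}`, a right step with left subtree `s` has asymptotic probability
`4^{-(|s|+1)}`, and a left step has `∑ C_k 4^{-(k+1)} = 1/2`. The product of these factors is
`beginWeight`.

Only lower bounds on the tree counts are proved (`eventually_mul_catalan_le_beginCount`). They
suffice: the proposed limit is a probability measure, so weak convergence follows from the
inequality `ν G ≤ liminf μ_n G` for open `G`. Such a `G` is exhausted by cylinders that fix the
first stretches. Different lists of equal length are incompatible (`BeginsWith.unique`), so the
bounds add up (`sum_beginWeight_le_liminf`), and the limit gives each list at most its weight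
(`measureReal_stretches_eq_le`).

A value of some `Y` above `1` leaves a gap among the values
(`eq_one_of_regInjection_mem_permutations`), and almost surely one occurs. Existence comes from an
infinite product measure. -/

theorem avoids312_iff {m : ℕ} {α : Type*} [LinearOrder α] (w : Fin m → α) :
    Avoids312 w ↔ ∀ i j k, i < j → j < k → ¬ (w j < w k ∧ w k < w i) := by
  constructor
  · rintro h i j k hij hjk ⟨h1, h2⟩
    apply h
    have hmono : StrictMono ![i, j, k] := by
      intro a b hab
      fin_cases a <;> fin_cases b <;> first | exact absurd hab (by decide) | skip
      · exact hij
      · exact hij.trans hjk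
      · exact hjk
    refine ⟨OrderEmbedding.ofStrictMono _ hmono, ?_⟩
    have h3 := h1.trans h2
    intro a b
    fin_cases a <;> fin_cases b <;>
      simp [pattern312, h1, h2, h3, h1.not_gt, h2.not_gt, h3.not_gt]
  · rintro h ⟨e, he⟩
    refine h (e 0) (e 1) (e 2) (e.strictMono (by decide)) (e.strictMono (by decide)) ⟨?_, ?_⟩
    · exact (he 1 2).2 (by simp [pattern312])
    · exact (he 2 0).2 (by simp [pattern312])

/-- A list no three of whose entries, read from left to right, are in the relative order `312`. -/
def ListAvoids312 {α : Type*} [LT α] (l : List α) : Prop :=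
  ∀ x y z, [x, y, z].Sublist l → ¬ (y < z ∧ z < x)

theorem List.triple_sublist_iff {α : Type*} {x y z : α} {l : List α} :
    [x, y, z].Sublist l ↔
      ∃ i j k : Fin l.length, i < j ∧ j < k ∧ l.get i = x ∧ l.get j = y ∧ l.get k = z := by
  rw [List.sublist_iff_exists_fin_orderEmbedding_get_eq]
  constructor
  · rintro ⟨f, hf⟩
    exact ⟨f ⟨0, by simp⟩, f ⟨1, by simp⟩, f ⟨2, by simp⟩, f.strictMono (by simp),
      f.strictMono (by simp [Fin.lt_def]), (hf ⟨0, by simp⟩).symm, (hf ⟨1, by simp⟩).symm,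
      (hf ⟨2, by simp⟩).symm⟩
  · rintro ⟨i, j, k, hij, hjk, rfl, rfl, rfl⟩
    have hmono : StrictMono (![i, j, k] : Fin 3 → Fin l.length) := by
      intro a b hab
      fin_cases a <;> fin_cases b <;> first | exact absurd hab (by decide) | skip
      · exact hij
      · exact hij.trans hjk
      · exact hjk
    refine ⟨OrderEmbedding.ofStrictMono _ hmono, ?_⟩
    intro ix
    change Fin 3 at ix
    fin_cases ix <;> rfl

theorem avoids312_get_iff {α : Type*} [LinearOrder α] {l : List α} :
    Avoids312 l.get ↔ ListAvoids312 l := by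
  rw [avoids312_iff]
  constructor
  · intro h x y z hs
    obtain ⟨i, j, k, hij, hjk, rfl, rfl, rfl⟩ := List.triple_sublist_iff.1 hs
    exact h i j k hij hjk
  · intro h i j k hij hjk
    exact h _ _ _ (List.triple_sublist_iff.2 ⟨i, j, k, hij, hjk, rfl, rfl, rfl⟩)

theorem listAvoids312_ofFn_iff {α : Type*} [LinearOrder α] {m : ℕ} {w : Fin m → α} :
    ListAvoids312 (List.ofFn w) ↔ Avoids312 w := by
  rw [← avoids312_get_iff, avoids312_iff, avoids312_iff]
  constructor
  · intro h i j k hij hjk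
    have := h (i.cast (List.length_ofFn (f := w)).symm) (j.cast (List.length_ofFn (f := w)).symm)
      (k.cast (List.length_ofFn (f := w)).symm) hij hjk
    simp only [List.get_ofFn] at this
    exact this
  · intro h i j k hij hjk
    have := h (i.cast (List.length_ofFn (f := w))) (j.cast (List.length_ofFn (f := w)))
      (k.cast (List.length_ofFn (f := w))) hij hjk
    simp only [List.get_ofFn]
    exact this

theorem ListAvoids312.sublist {α : Type*} [LT α] {l l' : List α} (h : ListAvoids312 l')
    (hl : l.Sublist l') : ListAvoids312 l :=
  fun x y z hs => h x y z (hs.trans hl)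

theorem listAvoids312_map_iff {α β : Type*} [LinearOrder α] [LinearOrder β] {f : α → β}
    (hf : StrictMono f) {l : List α} : ListAvoids312 (l.map f) ↔ ListAvoids312 l := by
  constructor
  · rintro h x y z hs ⟨h1, h2⟩
    exact h _ _ _ (hs.map f) ⟨hf h1, hf h2⟩
  · rintro h x y z hs ⟨h1, h2⟩
    obtain ⟨l', hl', he⟩ := List.sublist_map_iff.1 hs
    match l', he with
    | [a, b, c], he =>
      simp only [List.map_cons, List.map_nil, List.cons.injEq, and_true] at he
      obtain ⟨rfl, rfl, rfl⟩ := he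
      exact h _ _ _ hl' ⟨hf.lt_iff_lt.1 h1, hf.lt_iff_lt.1 h2⟩

/-! ### Binary trees and words avoiding `312` -/

/-- The word on the letters `a, a + 1, …` that codes a binary tree: the word of the left subtree,
then the smallest letter, then the word of the right subtree, where the letters of the left subtree
are smaller than those of the right one. -/
def treeWord : BinaryTree Unit → ℕ → List ℕ
  | .nil, _ => []
  | .node _ l r, a => treeWord l (a + 1) ++ a :: treeWord r (a + 1 + l.numNodes)

@[simp] theorem treeWord_nil (a : ℕ) : treeWord .nil a = [] := rfl

theorem treeWord_node (u : Unit) (l r : BinaryTree Unit) (a : ℕ) :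
    treeWord (.node u l r) a =
      treeWord l (a + 1) ++ a :: treeWord r (a + 1 + l.numNodes) := rfl

theorem treeWord_perm (t : BinaryTree Unit) (a : ℕ) :
    (treeWord t a).Perm (List.range' a t.numNodes) := by
  induction t generalizing a with
  | nil => simp
  | node u l r hl hr =>
    rw [treeWord_node, BinaryTree.numNodes, List.range'_succ, ← List.range'_append_1]
    exact List.perm_middle.trans (((hl _).append (hr _)).cons a)

@[simp] theorem length_treeWord (t : BinaryTree Unit) (a : ℕ) :
    (treeWord t a).length = t.numNodes := by
  simpa using (treeWord_perm t a).length_eq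

theorem mem_treeWord {t : BinaryTree Unit} {a x : ℕ} :
    x ∈ treeWord t a ↔ a ≤ x ∧ x < a + t.numNodes := by
  rw [(treeWord_perm t a).mem_iff, List.mem_range'_1]

theorem nodup_treeWord (t : BinaryTree Unit) (a : ℕ) : (treeWord t a).Nodup :=
  (treeWord_perm t a).nodup_iff.2 List.nodup_range'

theorem treeWord_injective (a : ℕ) : Function.Injective (treeWord · a) := by
  intro s t h
  dsimp only at h
  induction s generalizing t a with
  | nil => cases t with
    | nil => rfl
    | node _ l r => simp [treeWord_node] at h
  | node _ l r hl hr => cases t with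
    | nil => simp [treeWord_node] at h
    | node _ l' r' =>
      rw [treeWord_node, treeWord_node, List.append_cons_inj_of_notMem] at h
      · obtain ⟨h1, -, h2⟩ := h
        obtain rfl := hl _ h1
        obtain rfl := hr _ h2
        rfl
      · rw [mem_treeWord]
        omega
      · rw [mem_treeWord]
        omega

/-- In a pattern `312` the letter playing 2 is not the minimum `a`, and it is smaller than the
letter playing 3. So if 3 is played in `l`, then 2 is too, and the whole pattern lies in `l`.
Otherwise the pattern lies in `a :: r`, where `a` is too small to play 3. -/
theorem listAvoids312_append_cons {a : ℕ} {l r : List ℕ} (hl : ListAvoids312 l)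
    (hr : ListAvoids312 r) (hal : ∀ x ∈ l, a < x) (har : ∀ x ∈ r, a < x)
    (hlr : ∀ x ∈ l, ∀ y ∈ r, x < y) : ListAvoids312 (l ++ a :: r) := by
  have har' : ListAvoids312 (a :: r) := by
    rintro x y z hs ⟨h1, h2⟩
    rcases List.sublist_cons_iff.1 hs with hs | ⟨s, he, hs⟩
    · exact hr x y z hs ⟨h1, h2⟩
    · simp only [List.cons.injEq] at he
      obtain ⟨rfl, rfl⟩ := he
      have := har z (hs.subset (by simp))
      omega
  rintro x y z hs ⟨h1, h2⟩
  obtain ⟨s, t, he, hs, ht⟩ := List.sublist_append_iff.1 hs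
  match s, he with
  | [], he => subst he; exact har' _ _ _ ht ⟨h1, h2⟩
  | [x'], he =>
    simp only [List.singleton_append, List.cons.injEq] at he
    obtain ⟨rfl, rfl⟩ := he
    have hx : x ∈ l := hs.subset (by simp)
    have hz : z ∈ r := by
      rcases List.sublist_cons_iff.1 ht with ht | ⟨s, he, ht⟩
      · exact ht.subset (by simp)
      · simp only [List.cons.injEq] at he
        obtain ⟨rfl, rfl⟩ := he
        exact ht.subset (by simp)
    exact absurd h2 (hlr x hx z hz).not_gt
  | [x', y'], he =>
    simp only [List.cons_append, List.nil_append, List.cons.injEq] at he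
    obtain ⟨rfl, rfl, rfl⟩ := he
    have hy := hal y (hs.subset (by simp))
    have hx : x ∈ l := hs.subset (by simp)
    rcases List.mem_cons.1 (ht.subset (List.mem_singleton_self z)) with hz | hz
    · omega
    · exact absurd h2 (hlr x hx z hz).not_gt
  | [x', y', z'], he =>
    simp only [List.cons_append, List.nil_append, List.cons.injEq] at he
    obtain ⟨rfl, rfl, rfl, rfl⟩ := he
    exact hl _ _ _ hs ⟨h1, h2⟩
  | _ :: _ :: _ :: _ :: _, he => simp at he

theorem listAvoids312_treeWord (t : BinaryTree Unit) (a : ℕ) : ListAvoids312 (treeWord t a) := by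
  induction t generalizing a with
  | nil => intro x y z hs; simp at hs
  | node u l r hl hr =>
    refine listAvoids312_append_cons (hl _) (hr _) ?_ ?_ ?_ <;>
    · simp only [mem_treeWord]
      omega

/-- Every word avoiding `312` on an interval of letters codes a binary tree. -/
theorem exists_treeWord_eq (k : ℕ) : ∀ (a : ℕ) (w : List ℕ), w.Perm (List.range' a k) →
    ListAvoids312 w → ∃ t : BinaryTree Unit, t.numNodes = k ∧ treeWord t a = w := by
  induction k using Nat.strong_induction_on with
  | _ k ih =>
  intro a w hw hav
  cases k with
  | zero => exact ⟨.nil, rfl, by simpa using hw.symm⟩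
  | succ k =>
    have ha : a ∈ w := by rw [hw.mem_iff]; simp
    obtain ⟨l, r, rfl⟩ := List.append_of_mem ha
    have hp : (l ++ r).Perm (List.range' (a + 1) k) := by
      rw [List.range'_succ] at hw
      exact (List.perm_middle.symm.trans hw).cons_inv
    have hmem : ∀ x ∈ l ++ r, a + 1 ≤ x := fun x hx => by
      have := hp.mem_iff.1 hx
      rw [List.mem_range'_1] at this
      exact this.1
    have hnd : (l ++ r).Nodup := hp.nodup_iff.2 List.nodup_range'
    have hlr : ∀ x ∈ l, ∀ y ∈ r, x < y := by
      intro x hx y hy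
      -- The minimum `a` stands between `x` and `y`, so `y < x` would make `x, a, y` a pattern
      -- `312`.
      have h1 : [x, a, y].Sublist (l ++ a :: r) :=
        (List.singleton_sublist.2 hx).append ((List.singleton_sublist.2 hy).cons_cons a)
      have h2 := hav _ _ _ h1
      have h3 := hmem y (List.mem_append_right _ hy)
      have h4 : x ≠ y := fun h => (List.disjoint_of_nodup_append hnd) hx (h ▸ hy)
      omega
    have hlen : l.length + r.length = k := by simpa using hp.length_eq
    -- The sorted halves concatenate to a sorted list, hence to the interval itself. Cutting by
    -- length shows that each half fills an interval.
    have hsort : l.mergeSort ++ r.mergeSort =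
        List.range' (a + 1) l.length ++ List.range' (a + 1 + l.length) r.length := by
      rw [List.range'_append_1, hlen]
      refine List.Perm.eq_of_pairwise (le := (· ≤ ·)) (fun _ _ _ _ => le_antisymm) ?_ ?_ ?_
      · rw [List.pairwise_append]
        refine ⟨by simpa using List.pairwise_mergeSort' (· ≤ ·) l,
          by simpa using List.pairwise_mergeSort' (· ≤ ·) r, ?_⟩
        intro x hx y hy
        exact (hlr x (by simpa using hx) y (by simpa using hy)).le
      · exact (List.pairwise_lt_range' (s := a + 1) (n := k)).imp le_of_lt
      · exact ((List.mergeSort_perm l _).append (List.mergeSort_perm r _)).trans hp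
    obtain ⟨h1, h2⟩ := List.append_inj hsort (by simp)
    obtain ⟨tl, htl, rfl⟩ := ih l.length (by omega) (a + 1) l
      (h1 ▸ (List.mergeSort_perm l _).symm) (hav.sublist (List.sublist_append_left _ _))
    obtain ⟨tr, htr, rfl⟩ := ih r.length (by omega) (a + 1 + (treeWord tl (a + 1)).length) r
      (h2 ▸ (List.mergeSort_perm r _).symm)
      (hav.sublist ((List.sublist_cons_self _ _).trans (List.sublist_append_right _ _)))
    refine ⟨.node () tl tr, ?_, ?_⟩
    · simp only [BinaryTree.numNodes]
      omega
    · rw [treeWord_node]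
      simp

/-! ### Asymptotics of the Catalan numbers -/

theorem catalan_pos (n : ℕ) : 0 < catalan n := by
  have h := succ_mul_catalan_eq_centralBinom n
  have h2 := Nat.centralBinom_pos n
  by_contra h0
  rw [Nat.eq_zero_of_not_pos h0] at h
  omega

theorem succ_succ_mul_catalan_succ (n : ℕ) :
    (n + 2) * catalan (n + 1) = (4 * n + 2) * catalan n := by
  have h1 := succ_mul_catalan_eq_centralBinom n
  have h2 := succ_mul_catalan_eq_centralBinom (n + 1)
  have h3 := Nat.succ_mul_centralBinom_succ n
  apply Nat.eq_of_mul_eq_mul_left n.succ_pos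
  rw [Nat.succ_eq_add_one]
  rw [← h1, ← h2] at h3
  linarith

theorem tendsto_catalan_div_catalan_succ :
    Tendsto (fun n => (catalan n : ℝ) / catalan (n + 1)) atTop (𝓝 (1 / 4)) := by
  -- Partial fractions of `(n + 2) / (4n + 2)`.
  have h : ∀ n : ℕ, (catalan n : ℝ) / catalan (n + 1) = 1 / 4 + (3 / 8) * (1 / ((n : ℝ) + 1 / 2)) := by
    intro n
    have h1 : ((n : ℝ) + 2) * catalan (n + 1) = (4 * n + 2) * catalan n := by
      exact_mod_cast succ_succ_mul_catalan_succ n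
    have h2 : (0 : ℝ) < catalan (n + 1) := by exact_mod_cast catalan_pos _
    have h3 : (0 : ℝ) < (n : ℝ) + 1 / 2 := by positivity
    field_simp
    linarith
  simp_rw [h]
  have h4 : Tendsto (fun n : ℕ => 1 / ((n : ℝ) + 1 / 2)) atTop (𝓝 0) := by
    simp_rw [one_div]
    exact tendsto_inv_atTop_zero.comp
      (tendsto_atTop_add_const_right _ _ tendsto_natCast_atTop_atTop)
  have h5 := (h4.const_mul (3 / 8)).const_add (1 / 4)
  rwa [mul_zero, add_zero] at h5

theorem tendsto_catalan_div_catalan_add (j : ℕ) :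
    Tendsto (fun n => (catalan n : ℝ) / catalan (n + j)) atTop (𝓝 ((1 / 4) ^ j)) := by
  induction j with
  | zero =>
    refine tendsto_const_nhds.congr fun n => ?_
    have : (catalan n : ℝ) ≠ 0 := by exact_mod_cast (catalan_pos n).ne'
    simp [this]
  | succ j ih =>
    have h := ih.mul (tendsto_catalan_div_catalan_succ.comp (tendsto_add_atTop_nat j))
    rw [pow_succ]
    refine h.congr fun n => ?_
    have h1 : (catalan (n + j) : ℝ) ≠ 0 := by exact_mod_cast (catalan_pos _).ne'
    simp only [Function.comp_apply, ← add_assoc]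
    field_simp

theorem tendsto_catalan_sub_div_catalan (j : ℕ) :
    Tendsto (fun n => (catalan (n - j) : ℝ) / catalan n) atTop (𝓝 ((1 / 4) ^ j)) := by
  rw [← tendsto_add_atTop_iff_nat j]
  simpa using tendsto_catalan_div_catalan_add j

/-! ### Total mass of the law of `X` -/

theorem centralBinom_div_sq_le (n : ℕ) :
    ((n.centralBinom : ℝ) / 4 ^ n) ^ 2 ≤ 1 / (2 * n + 1) := by
  induction n with
  | zero => simp
  | succ n ih =>
    have h : ((n : ℝ) + 1) * (n + 1).centralBinom = 2 * (2 * n + 1) * n.centralBinom := by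
      exact_mod_cast Nat.succ_mul_centralBinom_succ n
    have h1 : ((n + 1).centralBinom : ℝ) / 4 ^ (n + 1) =
        (2 * n + 1) / (2 * n + 2) * ((n.centralBinom : ℝ) / 4 ^ n) := by
      field_simp
      rw [pow_succ]
      linear_combination 2 * (4 ^ n : ℝ) * h
    rw [h1, mul_pow]
    calc ((2 * (n : ℝ) + 1) / (2 * n + 2)) ^ 2 * ((n.centralBinom : ℝ) / 4 ^ n) ^ 2
        ≤ ((2 * (n : ℝ) + 1) / (2 * n + 2)) ^ 2 * (1 / (2 * n + 1)) := by gcongr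
      _ ≤ 1 / (2 * ((n + 1 : ℕ) : ℝ) + 1) := by
        push_cast
        rw [div_pow, div_mul_div_comm, div_le_div_iff₀ (by positivity) (by positivity)]
        nlinarith [sq_nonneg (n : ℝ)]

theorem tendsto_centralBinom_div :
    Tendsto (fun n : ℕ => (n.centralBinom : ℝ) / 4 ^ n) atTop (𝓝 0) := by
  have h : Tendsto (fun n : ℕ => ((n.centralBinom : ℝ) / 4 ^ n) ^ 2) atTop (𝓝 0) := by
    refine squeeze_zero (fun n => sq_nonneg _) centralBinom_div_sq_le ?_
    simp_rw [one_div]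
    refine tendsto_inv_atTop_zero.comp (tendsto_atTop_add_const_right _ _ ?_)
    exact tendsto_natCast_atTop_atTop.const_mul_atTop (by norm_num)
  have h2 := h.sqrt
  rw [Real.sqrt_zero] at h2
  refine h2.congr fun n => Real.sqrt_sq (by positivity)

/-- The sum telescopes: each term is the drop of `centralBinom k / 4 ^ k` from `k` to `k + 1`. -/
theorem sum_range_catalan_div (n : ℕ) :
    ∑ k ∈ Finset.range n, (catalan k : ℝ) / (2 * 4 ^ k) = 1 - (n.centralBinom : ℝ) / 4 ^ n := by
  induction n with
  | zero => simp
  | succ n ih =>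
    have h : ((n : ℝ) + 1) * (n + 1).centralBinom = 2 * (2 * n + 1) * n.centralBinom := by
      exact_mod_cast Nat.succ_mul_centralBinom_succ n
    have h2 : ((n : ℝ) + 1) * catalan n = n.centralBinom := by
      exact_mod_cast succ_mul_catalan_eq_centralBinom n
    rw [← h2] at h
    have h3 : ((n + 1).centralBinom : ℝ) = 2 * (2 * n + 1) * catalan n := by
      apply mul_left_cancel₀ (show (n : ℝ) + 1 ≠ 0 by positivity)
      linarith
    rw [Finset.sum_range_succ, ih, h3, ← h2, pow_succ]
    field_simp
    ring

theorem hasSum_catalan_div : HasSum (fun k => (catalan k : ℝ) / (2 * 4 ^ k)) 1 := by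
  rw [hasSum_iff_tendsto_nat_of_nonneg (fun _ => by positivity)]
  simp_rw [sum_range_catalan_div]
  simpa using tendsto_centralBinom_div.const_sub 1

/-! ### Trees with a given beginning

Walk down a binary tree from its root, always to the larger subtree, and split the walk after every
step to the right. A stretch of the walk is recorded as the pair of its number of steps to the left
and of the left subtree at its last vertex. -/

/-- The walk towards larger subtrees in the tree begins with the given stretches. -/
def BeginsWith : BinaryTree Unit → List (ℕ × BinaryTree Unit) → Prop
  | _, [] => True
  | .nil, _ :: _ => False
  | .node _ l r, (0, s) :: d => l = s ∧ l.numNodes ≤ r.numNodes ∧ BeginsWith r d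
  | .node _ l r, (y + 1, s) :: d => r.numNodes < l.numNodes ∧ BeginsWith l ((y, s) :: d)

/-- The initial part, determined by the first stretches of the walk, of the word of a tree. -/
def beginWord : List (ℕ × BinaryTree Unit) → ℕ → List ℕ
  | [], _ => []
  | (y, s) :: d, a => treeWord s (a + y + 1) ++ (a + y) :: beginWord d (a + y + 1 + s.numNodes)

/-- The limiting probability of a list of stretches. -/
noncomputable def beginWeight (d : List (ℕ × BinaryTree Unit)) : ℝ :=
  (d.map fun p => (1 / 2 : ℝ) ^ (p.1 + 1) / (2 * 4 ^ p.2.numNodes)).prod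

theorem beginWeight_cons (p : ℕ × BinaryTree Unit) (d : List (ℕ × BinaryTree Unit)) :
    beginWeight (p :: d) =
      (1 / 2 : ℝ) ^ (p.1 + 1) / (2 * 4 ^ p.2.numNodes) * beginWeight d := by
  simp [beginWeight]

theorem beginWeight_nonneg (d : List (ℕ × BinaryTree Unit)) : 0 ≤ beginWeight d := by
  refine List.prod_nonneg fun x hx => ?_
  obtain ⟨p, -, rfl⟩ := List.mem_map.1 hx
  positivity

/-- The word of the left subtree opens the word of the tree, so a left step keeps the prefix and
only raises the first available letter by one. -/
theorem BeginsWith.prefix {t : BinaryTree Unit} {d : List (ℕ × BinaryTree Unit)}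
    (h : BeginsWith t d) (a : ℕ) : (beginWord d a).IsPrefix (treeWord t a) := by
  induction t generalizing d a with
  | nil => cases d with
    | nil => simp [beginWord]
    | cons _ _ => exact h.elim
  | node _ l r hl hr => match d, h with
    | [], _ => simp [beginWord]
    | (0, s) :: d, h =>
      obtain ⟨rfl, -, h⟩ := h
      simp only [beginWord, treeWord_node, add_zero]
      exact (List.prefix_append_right_inj _).2 (List.cons_prefix_cons.2 ⟨rfl, hr h _⟩)
    | (y + 1, s) :: d, h =>
      refine List.IsPrefix.trans ?_ (List.prefix_append _ _)
      have h1 := hl h.2 (a + 1)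
      simp only [beginWord] at h1 ⊢
      rwa [show a + (y + 1) = a + 1 + y by omega]

/-- The sizes of the two subtrees decide every step, ties going right, so the walk is determined by
the tree. -/
theorem BeginsWith.unique {t : BinaryTree Unit} {d d' : List (ℕ × BinaryTree Unit)}
    (h : BeginsWith t d) (h' : BeginsWith t d') (hd : d.length = d'.length) : d = d' := by
  induction t generalizing d d' with
  | nil => match d, d', h, h', hd with
    | [], [], _, _, _ => rfl
  | node _ l r hl hr => match d, d', h, h', hd with
    | [], [], _, _, _ => rfl
    | (0, s) :: d, (0, s') :: d', h, h', hd =>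
      obtain ⟨rfl, -, h⟩ := h
      obtain ⟨rfl, -, h'⟩ := h'
      rw [hr h h' (by simpa using hd)]
    | (y + 1, s) :: d, (0, s') :: d', h, h', hd => exact absurd h'.2.1 h.1.not_ge
    | (0, s) :: d, (y + 1, s') :: d', h, h', hd => exact absurd h.2.1 h'.1.not_ge
    | (y + 1, s) :: d, (y' + 1, s') :: d', h, h', hd =>
      have := hl h.2 h'.2 (by simpa using hd)
      simp only [List.cons.injEq, Prod.mk.injEq] at this ⊢
      exact ⟨⟨by omega, this.1.2⟩, this.2⟩

open Classical in
/-- The number of trees with `n` vertices that begin with given stretches. -/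
noncomputable def beginCount (n : ℕ) (d : List (ℕ × BinaryTree Unit)) : ℕ :=
  ((BinaryTree.treesOfNumNodesEq n).filter (BeginsWith · d)).card

/-! ### Lower bounds for the number of trees with a given beginning -/

theorem beginCount_nil (n : ℕ) : beginCount n [] = catalan n := by
  simp [beginCount, BeginsWith, BinaryTree.treesOfNumNodesEq_card_eq_catalan]

/-- Attach `s` as left subtree. The bound on `n` makes the right subtree at least as large, so that
the walk goes right. -/
theorem beginCount_le_zero_cons {n : ℕ} {s : BinaryTree Unit} (d : List (ℕ × BinaryTree Unit))
    (hn : 2 * s.numNodes + 1 ≤ n) :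
    beginCount (n - (s.numNodes + 1)) d ≤ beginCount n ((0, s) :: d) := by
  classical
  refine Finset.card_le_card_of_injOn (fun t => .node () s t) ?_ ?_
  · intro t ht
    simp only [Finset.coe_filter, BinaryTree.mem_treesOfNumNodesEq, Set.mem_ofPred_eq,
      BinaryTree.numNodes, BeginsWith] at ht ⊢
    exact ⟨by omega, trivial, by omega, ht.2⟩
  · intro t _ t' _ h
    simpa using h

/-- Attach a right subtree with `k < K` vertices. Since `2 * K ≤ n`, it is strictly smaller than the
left one, so that the walk goes left. -/
theorem sum_beginCount_le_succ_cons {n K : ℕ} (y : ℕ) (s : BinaryTree Unit)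
    (d : List (ℕ × BinaryTree Unit)) (hn : 2 * K ≤ n) :
    ∑ k ∈ Finset.range K, catalan k * beginCount (n - (k + 1)) ((y, s) :: d) ≤
      beginCount n ((y + 1, s) :: d) := by
  classical
  have h : ∑ k ∈ Finset.range K, catalan k * beginCount (n - (k + 1)) ((y, s) :: d) =
      ((Finset.range K).sigma fun k => BinaryTree.treesOfNumNodesEq k ×ˢ
        (BinaryTree.treesOfNumNodesEq (n - (k + 1))).filter
          (BeginsWith · ((y, s) :: d))).card := by
    simp [Finset.card_sigma, beginCount, BinaryTree.treesOfNumNodesEq_card_eq_catalan]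
  rw [h]
  refine Finset.card_le_card_of_injOn (fun p => .node () p.2.2 p.2.1) ?_ ?_
  · rintro ⟨k, r, l⟩ hp
    simp only [Finset.coe_sigma, Set.mem_sigma_iff, Finset.coe_range, Set.mem_Iio,
      Finset.mem_coe, Finset.mem_product, Finset.mem_filter,
      BinaryTree.mem_treesOfNumNodesEq] at hp
    simp only [Finset.coe_filter, BinaryTree.mem_treesOfNumNodesEq, Set.mem_ofPred_eq,
      BinaryTree.numNodes, BeginsWith]
    exact ⟨by omega, by omega, hp.2.2.2⟩
  · rintro ⟨k, r, l⟩ hp ⟨k', r', l'⟩ hp' h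
    simp only [Finset.coe_sigma, Set.mem_sigma_iff, Finset.coe_range, Set.mem_Iio,
      Finset.mem_coe, Finset.mem_product, Finset.mem_filter,
      BinaryTree.mem_treesOfNumNodesEq] at hp hp'
    simp only [BinaryTree.node.injEq, true_and] at h
    obtain ⟨rfl, rfl⟩ := h
    obtain rfl : k = k' := hp.2.1.symm.trans hp'.2.1
    rfl

/-- The hypothesis `hf` says `liminf f n / C_n ≥ W`. A shift by `k + 1` costs the factor
`4^{-(k+1)}`, the limit of `C_{n-k-1} / C_n`, and finitely many such bounds can be added. -/
theorem eventually_le_sum_catalan_mul {f : ℕ → ℝ} {W q : ℝ} (A : Finset ℕ) (b : ℕ → ℝ)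
    (hb : ∀ k, 0 ≤ b k) (hf : ∀ q < W, ∀ᶠ n in atTop, q * catalan n ≤ f n)
    (hq : q < (∑ k ∈ A, b k * (1 / 4) ^ (k + 1)) * W) :
    ∀ᶠ n in atTop, q * catalan n ≤ ∑ k ∈ A, b k * f (n - (k + 1)) := by
  -- Part of the slack is kept for `f` (`r < W`), the rest for the convergence of the Catalan
  -- ratios.
  obtain ⟨r, hr, hrW⟩ : ∃ r, q < (∑ k ∈ A, b k * (1 / 4) ^ (k + 1)) * r ∧ r < W := by
    have h1 : Tendsto (fun r => (∑ k ∈ A, b k * (1 / 4 : ℝ) ^ (k + 1)) * r) (𝓝[<] W)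
        (𝓝 ((∑ k ∈ A, b k * (1 / 4) ^ (k + 1)) * W)) :=
      (tendsto_id.const_mul _).mono_left nhdsWithin_le_nhds
    exact ((h1.eventually_const_lt hq).and self_mem_nhdsWithin).exists
  have h2 : Tendsto (fun n => (∑ k ∈ A, b k * ((catalan (n - (k + 1)) : ℝ) / catalan n)) * r)
      atTop (𝓝 ((∑ k ∈ A, b k * (1 / 4) ^ (k + 1)) * r)) :=
    (tendsto_finsetSum _ fun k _ =>
      (tendsto_catalan_sub_div_catalan (k + 1)).const_mul _).mul_const _
  have h3 : ∀ᶠ n in atTop, ∀ k ∈ A, r * catalan (n - (k + 1)) ≤ f (n - (k + 1)) :=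
    (Filter.eventually_all_finset _).2 fun k _ =>
      (tendsto_sub_atTop_nat (k + 1)).eventually (hf r hrW)
  filter_upwards [h2.eventually_const_lt hr, h3] with n hn1 hn2
  have hc : (0 : ℝ) < catalan n := by exact_mod_cast catalan_pos n
  calc q * catalan n
      ≤ ((∑ k ∈ A, b k * ((catalan (n - (k + 1)) : ℝ) / catalan n)) * r) * catalan n := by gcongr
    _ = ∑ k ∈ A, b k * (r * catalan (n - (k + 1))) := by
      rw [Finset.sum_mul, Finset.sum_mul]
      refine Finset.sum_congr rfl fun k _ => ?_
      field_simp
    _ ≤ ∑ k ∈ A, b k * f (n - (k + 1)) :=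
      Finset.sum_le_sum fun k hk => mul_le_mul_of_nonneg_left (hn2 k hk) (hb k)

theorem tendsto_sum_catalan_mul_pow :
    Tendsto (fun K => ∑ k ∈ Finset.range K, (catalan k : ℝ) * (1 / 4) ^ (k + 1)) atTop
      (𝓝 (1 / 2)) := by
  have h := (hasSum_catalan_div.mul_left (1 / 2)).tendsto_sum_nat
  rw [mul_one] at h
  refine h.congr fun K => Finset.sum_congr rfl fun k _ => ?_
  rw [pow_succ, div_pow, one_pow]
  ring

/-- Induction along the walk: the outer one removes right steps, the inner one left steps. A left
step halves the weight, a factor approached by truncating the series over the right subtree at a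
finite `K`. -/
theorem eventually_mul_catalan_le_beginCount (d : List (ℕ × BinaryTree Unit)) :
    ∀ q < beginWeight d, ∀ᶠ n in atTop, q * catalan n ≤ beginCount n d := by
  induction d with
  | nil =>
    intro q hq
    refine Eventually.of_forall fun n => ?_
    rw [beginCount_nil]
    have hq : q ≤ 1 := by simpa [beginWeight] using hq.le
    exact mul_le_of_le_one_left (Nat.cast_nonneg _) hq
  | cons p d ih =>
    obtain ⟨y, s⟩ := p
    induction y with
    | zero =>
      intro q hq
      have h := eventually_le_sum_catalan_mul (f := fun n => beginCount n d) (W := beginWeight d)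
        (q := q) {s.numNodes} (fun _ => 1) (fun _ => zero_le_one) ih (by
          rw [beginWeight_cons] at hq
          refine hq.trans_eq ?_
          simp only [Finset.sum_singleton, one_mul, zero_add, pow_succ, one_div, inv_pow]
          ring)
      filter_upwards [h, eventually_ge_atTop (2 * s.numNodes + 1)] with n hn1 hn2
      refine hn1.trans ?_
      simp only [Finset.sum_singleton, one_mul]
      exact_mod_cast beginCount_le_zero_cons d hn2
    | succ y ihy =>
      intro q hq
      have h1 : beginWeight ((y + 1, s) :: d) = 1 / 2 * beginWeight ((y, s) :: d) := by
        rw [beginWeight_cons, beginWeight_cons, pow_succ]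
        ring
      rw [h1] at hq
      obtain ⟨K, hK⟩ := ((tendsto_sum_catalan_mul_pow.mul_const
        (beginWeight ((y, s) :: d))).eventually_const_lt hq).exists
      have h := eventually_le_sum_catalan_mul (f := fun n => beginCount n ((y, s) :: d))
        (q := q) (Finset.range K) (fun k => (catalan k : ℝ)) (fun _ => Nat.cast_nonneg _) ihy hK
      filter_upwards [h, eventually_ge_atTop (2 * K)] with n hn1 hn2
      refine hn1.trans ?_
      exact_mod_cast sum_beginCount_le_succ_cons y s d hn2

/-! ### Permutations and trees -/

/-- Needed because permutations of `Fin n` use letters from `0`, while points of `GenInj` use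
letters from `1`. -/
theorem treeWord_add (t : BinaryTree Unit) (a b : ℕ) :
    treeWord t (a + b) = (treeWord t a).map (· + b) := by
  induction t generalizing a with
  | nil => rfl
  | node _ l r hl hr =>
    rw [treeWord_node, treeWord_node, List.map_append, List.map_cons, ← hl, ← hr]
    simp only [add_right_comm]

/-- The word `π 0, π 1, …` of a permutation. -/
def permWord {n : ℕ} (π : Equiv.Perm (Fin n)) : List ℕ := List.ofFn fun i => (π i : ℕ)

theorem permWord_injective {n : ℕ} : Function.Injective (permWord (n := n)) := by
  intro π ρ h
  ext i
  exact congrFun (List.ofFn_injective h) i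

theorem permWord_perm {n : ℕ} (π : Equiv.Perm (Fin n)) :
    (permWord π).Perm (List.range' 0 n) := by
  rw [permWord, List.perm_ext_iff_of_nodup (List.nodup_ofFn.2 ?_) List.nodup_range']
  · intro x
    simp only [List.mem_ofFn, List.mem_range'_1, zero_le, zero_add, true_and]
    constructor
    · rintro ⟨i, rfl⟩
      exact (π i).isLt
    · intro hx
      exact ⟨π.symm ⟨x, hx⟩, by simp⟩
  · exact Fin.val_injective.comp π.injective

theorem listAvoids312_permWord {n : ℕ} {π : Equiv.Perm (Fin n)} :
    ListAvoids312 (permWord π) ↔ Avoids312 fun i => π i := by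
  rw [permWord, listAvoids312_ofFn_iff, avoids312_iff, avoids312_iff]
  rfl

theorem exists_treeWord_eq_permWord {n : ℕ} (π : AvoidingPerm n) :
    ∃ t : BinaryTree Unit, t ∈ BinaryTree.treesOfNumNodesEq n ∧ treeWord t 0 = permWord π.1 := by
  obtain ⟨t, ht, h⟩ :=
    exists_treeWord_eq n 0 _ (permWord_perm π.1) (listAvoids312_permWord.2 π.2)
  exact ⟨t, BinaryTree.mem_treesOfNumNodesEq.2 ht, h⟩

theorem exists_permWord_eq_treeWord {n : ℕ} {t : BinaryTree Unit} (ht : t.numNodes = n) :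
    ∃ π : AvoidingPerm n, treeWord t 0 = permWord π.1 := by
  subst ht
  have hlt : ∀ i : Fin t.numNodes, (treeWord t 0)[(i : ℕ)]'(by simp) < t.numNodes := by
    intro i
    simpa using (mem_treeWord.1 (List.getElem_mem (l := treeWord t 0) (n := i) (by simp))).2
  let f : Fin t.numNodes → Fin t.numNodes := fun i => ⟨_, hlt i⟩
  have hf : Function.Injective f := by
    intro i j hij
    have := congrArg Fin.val hij
    exact Fin.ext ((nodup_treeWord t 0).getElem_inj_iff.1 this)
  let π : Equiv.Perm (Fin t.numNodes) := Equiv.ofBijective f (Finite.injective_iff_bijective.1 hf)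
  have hπ : treeWord t 0 = permWord π := by
    refine List.ext_getElem (by simp [permWord]) fun i h1 h2 => ?_
    simp [permWord, π, f]
  exact ⟨⟨π, listAvoids312_permWord.1 (hπ ▸ listAvoids312_treeWord t 0)⟩, hπ⟩

/-- The tree that codes a permutation avoiding `312`. -/
noncomputable def permTree {n : ℕ} (π : AvoidingPerm n) : BinaryTree.treesOfNumNodesEq n :=
  ⟨_, (exists_treeWord_eq_permWord π).choose_spec.1⟩

theorem treeWord_permTree {n : ℕ} (π : AvoidingPerm n) :
    treeWord (permTree π).1 0 = permWord π.1 :=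
  (exists_treeWord_eq_permWord π).choose_spec.2

theorem permTree_bijective (n : ℕ) : Function.Bijective (permTree (n := n)) := by
  constructor
  · intro π ρ h
    apply Subtype.ext
    apply permWord_injective
    rw [← treeWord_permTree, ← treeWord_permTree, h]
  · rintro ⟨t, ht⟩
    obtain ⟨π, hπ⟩ := exists_permWord_eq_treeWord (BinaryTree.mem_treesOfNumNodesEq.1 ht)
    refine ⟨π, Subtype.ext (treeWord_injective 0 ?_)⟩
    change treeWord _ 0 = treeWord t 0
    rw [treeWord_permTree, hπ]

theorem card_avoidingPerm (n : ℕ) : Fintype.card (AvoidingPerm n) = catalan n := by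
  rw [Fintype.card_of_bijective (permTree_bijective n), Fintype.card_coe,
    BinaryTree.treesOfNumNodesEq_card_eq_catalan]

theorem mu312_apply (n : ℕ) {G : Set GenInj} (hG : MeasurableSet G) :
    (mu312 n : Measure GenInj) G =
      Nat.card {π : AvoidingPerm n // embedPerm π.1 ∈ G} / (catalan n : ENNReal) := by
  classical
  change ((PMF.uniformOfFintype (AvoidingPerm n)).map fun π => embedPerm π.1).toMeasure G = _
  rw [PMF.toMeasure_apply_eq_toOuterMeasure_apply _ hG, PMF.toOuterMeasure_map_apply,
    PMF.toOuterMeasure_uniformOfFintype_apply, card_avoidingPerm, ← Nat.card_eq_fintype_card]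
  rfl

/-! ### Cylinder sets given by the beginning of a tree -/

/-- The sequences whose first `m` terms are those of the word given by stretches of a tree. -/
def beginCylinder (m : ℕ) (d : List (ℕ × BinaryTree Unit)) : Set GenInj :=
  {σ | ∀ i v : ℕ+, (i : ℕ) ≤ m → (beginWord d 1)[(i : ℕ) - 1]? = some (v : ℕ) →
    σ i = (v : OnePoint ℕ+)}

theorem embedPerm_mem_beginCylinder {n m : ℕ} (hmn : m ≤ n) {π : AvoidingPerm n}
    {d : List (ℕ × BinaryTree Unit)} (h : BeginsWith (permTree π).1 d) :
    embedPerm π.1 ∈ beginCylinder m d := by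
  intro i v him hv
  have hi := i.pos
  have hp := h.prefix 1
  rw [show (1 : ℕ) = 0 + 1 from rfl, treeWord_add, treeWord_permTree] at hp
  have h1 := List.prefix_iff_getElem?.1 hp ((i : ℕ) - 1) (by
    obtain ⟨h, -⟩ := List.getElem?_eq_some_iff.1 hv
    exact h)
  obtain ⟨h2, h3⟩ := List.getElem?_eq_some_iff.1 hv
  simp only [zero_add] at h1
  rw [h3, List.getElem?_eq_some_iff] at h1
  obtain ⟨h4, h5⟩ := h1
  change ((extendPerm π.1 i : ℕ+) : OnePoint ℕ+) = _
  congr 1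
  apply PNat.coe_injective
  rw [← h5, extendPerm, dif_pos (by omega)]
  simp [permWord]

/-! ### Lower bounds for `mu312` on unions of cylinders -/

theorem sum_beginCount_div_le_mu312 {n m : ℕ} (hmn : m ≤ n) {G : Set GenInj}
    (hG : MeasurableSet G) (A : Finset (List (ℕ × BinaryTree Unit)))
    (hA : ∀ d ∈ A, d.length = m ∧ beginCylinder m d ⊆ G) :
    ((∑ d ∈ A, beginCount n d : ℕ) : ENNReal) / catalan n ≤ (mu312 n : Measure GenInj) G := by
  classical
  rw [mu312_apply n hG]
  gcongr
  have h1 : ∑ d ∈ A, beginCount n d =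
      (A.biUnion fun d => (BinaryTree.treesOfNumNodesEq n).filter (BeginsWith · d)).card := by
    rw [Finset.card_biUnion]
    · rfl
    · intro d hd d' hd' hne
      rw [Function.onFun, Finset.disjoint_left]
      intro t ht ht'
      exact hne ((Finset.mem_filter.1 ht).2.unique (Finset.mem_filter.1 ht').2
        ((hA d hd).1.trans (hA d' hd').1.symm))
  rw [h1, Nat.card_eq_fintype_card, Fintype.card_subtype]
  refine Finset.card_le_card_of_surjOn (fun π => (permTree π).1) ?_
  intro t ht
  obtain ⟨d, hd, ht⟩ := Finset.mem_biUnion.1 (Finset.mem_coe.1 ht)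
  obtain ⟨ht, hb⟩ := Finset.mem_filter.1 ht
  obtain ⟨π, hπ⟩ := (permTree_bijective n).2 ⟨t, ht⟩
  obtain rfl : (permTree π).1 = t := by rw [hπ]
  refine ⟨π, ?_, rfl⟩
  simp only [Finset.coe_filter, Finset.mem_univ, true_and, Set.mem_ofPred_eq]
  exact (hA d hd).2 (embedPerm_mem_beginCylinder hmn hb)

theorem sum_beginWeight_le_liminf {m : ℕ} {G : Set GenInj} (hG : MeasurableSet G)
    (A : Finset (List (ℕ × BinaryTree Unit)))
    (hA : ∀ d ∈ A, d.length = m ∧ beginCylinder m d ⊆ G) :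
    ENNReal.ofReal (∑ d ∈ A, beginWeight d) ≤
      liminf (fun n => (mu312 n : Measure GenInj) G) atTop := by
  refine le_of_forall_lt fun r hr => ?_
  have hr_top : r ≠ ⊤ := hr.ne_top
  rw [ENNReal.lt_ofReal_iff_toReal_lt hr_top] at hr
  obtain ⟨q, hrq, hq⟩ := exists_between hr
  refine lt_of_lt_of_le (b := ENNReal.ofReal q) ((ENNReal.lt_ofReal_iff_toReal_lt hr_top).2 hrq) ?_
  -- The slack is shared equally among the members of `A`; the extra `1` in the denominator covers
  -- empty `A`.
  set ε : ℝ := (∑ d ∈ A, beginWeight d - q) / (A.card + 1) with hε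
  have hε0 : 0 < ε := div_pos (by linarith) (by positivity)
  have hsum : q ≤ ∑ d ∈ A, (beginWeight d - ε) := by
    have h1 : ε * (A.card + 1) = ∑ d ∈ A, beginWeight d - q := by
      rw [hε]
      field_simp
    rw [Finset.sum_sub_distrib, Finset.sum_const, nsmul_eq_mul]
    linarith
  have hev : ∀ᶠ n in atTop, ∀ d ∈ A, (beginWeight d - ε) * catalan n ≤ beginCount n d :=
    (Filter.eventually_all_finset _).2 fun d _ =>
      eventually_mul_catalan_le_beginCount d _ (by linarith)
  refine le_liminf_of_le (by isBoundedDefault) ?_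
  filter_upwards [hev, eventually_ge_atTop m] with n hn hmn
  refine le_trans ?_ (sum_beginCount_div_le_mu312 hmn hG A hA)
  have hc : (0 : ℝ) < catalan n := by exact_mod_cast catalan_pos n
  rw [← ENNReal.ofReal_natCast, ← ENNReal.ofReal_natCast, ← ENNReal.ofReal_div_of_pos hc]
  refine ENNReal.ofReal_le_ofReal ?_
  rw [le_div_iff₀ hc]
  push_cast
  calc q * catalan n ≤ (∑ d ∈ A, (beginWeight d - ε)) * catalan n := by gcongr
    _ = ∑ d ∈ A, (beginWeight d - ε) * catalan n := Finset.sum_mul _ _ _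
    _ ≤ _ := Finset.sum_le_sum hn

/-! ### Permutation images and trees -/

theorem Block.exists_mem_iff (I : Block) :
    ∃ p k : ℕ, 0 < p ∧ ∀ j : ℕ+, j ∈ I.1 ↔ p ≤ j ∧ (j : ℕ) < p + k := by
  obtain ⟨I, a, b, rfl⟩ := I
  refine ⟨a, b + 1 - a, a.pos, fun j => ?_⟩
  rw [Finset.mem_Icc, ← PNat.coe_le_coe, ← PNat.coe_le_coe]
  omega

section AvoidingImage

variable {I : Block} {p k : ℕ}

theorem exists_treeWord_eq_map_image (hp : 0 < p)
    (hI : ∀ j : ℕ+, j ∈ I.1 ↔ p ≤ j ∧ (j : ℕ) < p + k) (l : AvoidingImage I) :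
    ∃ t : BinaryTree Unit, t.numNodes = k ∧ treeWord t p = l.1.map PNat.val := by
  refine exists_treeWord_eq k p _ ?_ ?_
  · rw [List.perm_ext_iff_of_nodup (l.2.1.map PNat.coe_injective) List.nodup_range']
    intro x
    rw [List.mem_map, List.mem_range'_1]
    constructor
    · rintro ⟨j, hj, rfl⟩
      exact (hI j).1 ((l.2.2.1 j).1 hj)
    · intro hx
      exact ⟨⟨x, hp.trans_le hx.1⟩, (l.2.2.1 _).2 ((hI _).2 hx), rfl⟩
  · exact (listAvoids312_map_iff (f := PNat.val) (fun _ _ h => h)).2 (avoids312_get_iff.1 l.2.2.2)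

theorem exists_image_map_eq_treeWord (hp : 0 < p)
    (hI : ∀ j : ℕ+, j ∈ I.1 ↔ p ≤ j ∧ (j : ℕ) < p + k) {t : BinaryTree Unit}
    (ht : t.numNodes = k) : ∃ l : AvoidingImage I, treeWord t p = l.1.map PNat.val := by
  -- The default value of `Nat.toPNat'` at `0` plays no role, as all letters are at least `p > 0`.
  have h : ((treeWord t p).map Nat.toPNat').map PNat.val = treeWord t p := by
    rw [List.map_map]
    refine (List.map_congr_left fun x hx => ?_).trans (List.map_id _)
    have := (mem_treeWord.1 hx).1
    simp [Nat.toPNat'_coe, hp.trans_le this]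
  refine ⟨⟨(treeWord t p).map Nat.toPNat', ?_, fun j => ?_, ?_⟩, h.symm⟩
  · exact List.Nodup.of_map PNat.val (h.symm ▸ nodup_treeWord t p)
  · rw [hI, ← ht, ← mem_treeWord, ← h, List.mem_map_of_injective PNat.coe_injective, h]
  · rw [avoids312_get_iff, ← listAvoids312_map_iff (f := PNat.val) (fun _ _ h => h), h]
    exact listAvoids312_treeWord t p

/-- The tree that codes a permutation image avoiding `312`. -/
noncomputable def imageTree (hp : 0 < p)
    (hI : ∀ j : ℕ+, j ∈ I.1 ↔ p ≤ j ∧ (j : ℕ) < p + k) (l : AvoidingImage I) :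
    BinaryTree.treesOfNumNodesEq k :=
  ⟨_, BinaryTree.mem_treesOfNumNodesEq.2 (exists_treeWord_eq_map_image hp hI l).choose_spec.1⟩

theorem treeWord_imageTree (hp : 0 < p)
    (hI : ∀ j : ℕ+, j ∈ I.1 ↔ p ≤ j ∧ (j : ℕ) < p + k) (l : AvoidingImage I) :
    treeWord (imageTree hp hI l).1 p = l.1.map PNat.val :=
  (exists_treeWord_eq_map_image hp hI l).choose_spec.2

theorem imageTree_bijective (hp : 0 < p)
    (hI : ∀ j : ℕ+, j ∈ I.1 ↔ p ≤ j ∧ (j : ℕ) < p + k) :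
    Function.Bijective (imageTree hp hI) := by
  constructor
  · intro l l' h
    apply Subtype.ext
    apply List.map_injective_iff.2 PNat.coe_injective
    change l.1.map PNat.val = l'.1.map PNat.val
    rw [← treeWord_imageTree hp hI, ← treeWord_imageTree hp hI, h]
  · rintro ⟨t, ht⟩
    obtain ⟨l, hl⟩ := exists_image_map_eq_treeWord hp hI (BinaryTree.mem_treesOfNumNodesEq.1 ht)
    refine ⟨l, Subtype.ext (treeWord_injective p ?_)⟩
    change treeWord _ p = treeWord t p
    rw [treeWord_imageTree, hl]

theorem card_avoidingImage (hp : 0 < p)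
    (hI : ∀ j : ℕ+, j ∈ I.1 ↔ p ≤ j ∧ (j : ℕ) < p + k) :
    Nat.card (AvoidingImage I) = catalan k := by
  rw [Nat.card_eq_of_bijective _ (imageTree_bijective hp hI), Nat.card_eq_fintype_card,
    Fintype.card_coe, BinaryTree.treesOfNumNodesEq_card_eq_catalan]

end AvoidingImage

instance (I : Block) : Finite (AvoidingImage I) := by
  obtain ⟨p, k, hp, hI⟩ := I.exists_mem_iff
  exact Finite.of_injective _ (imageTree_bijective hp hI).1

instance (I : Block) : Nonempty (AvoidingImage I) := by
  obtain ⟨p, k, hp, hI⟩ := I.exists_mem_iff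
  have h : Nat.card (AvoidingImage I) ≠ 0 := by
    rw [card_avoidingImage hp hI]
    exact (catalan_pos k).ne'
  exact (Nat.card_ne_zero.1 h).1

/-! ### The stretches of the regenerative injection -/

section Stretches

variable (x : ℕ → ℕ) (y : ℕ → ℕ+) (w : (I : Block) → AvoidingImage I)

theorem mem_regBlock_iff (n : ℕ) (j : ℕ+) :
    j ∈ (regBlock x y n).1 ↔
      (singletonValue x y n : ℕ) + 1 ≤ j ∧ (j : ℕ) < singletonValue x y n + 1 + x n := by
  change j ∈ Finset.Icc _ _ ↔ _
  rw [Finset.mem_Icc, ← PNat.coe_le_coe, ← PNat.coe_le_coe, PNat.add_coe, coe_blockEnd,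
    coe_singletonValue, partialSum_succ]
  simp only [PNat.one_coe]
  omega

theorem card_avoidingImage_regBlock (n : ℕ) :
    Nat.card (AvoidingImage (regBlock x y n)) = catalan (x n) :=
  card_avoidingImage (Nat.succ_pos _) (mem_regBlock_iff x y n)

/-- Distinct segments occupy disjoint ranges, so only empty blocks coincide. These really are one
and the same block, so several segments may share one variable `Π_∅`; its law is trivial, which
saves the product formula. -/
theorem regBlock_eq_imp {i j : ℕ} (hij : i ≠ j) (h : regBlock x y i = regBlock x y j) :
    x i = 0 := by
  by_contra hx
  have h1 : singletonValue x y i + 1 ∈ (regBlock x y i).1 := by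
    rw [mem_regBlock_iff, PNat.add_coe, PNat.one_coe]
    omega
  have h2 := h1
  rw [h] at h2
  have h1 := mem_regBlock h1
  have h2 := mem_regBlock h2
  rw [coe_singletonValue, coe_blockEnd] at h1 h2
  rcases lt_or_gt_of_ne hij with hij | hij
  · have h3 : partialSum x (i + 1) ≤ partialSum x j := partialSum_mono x hij
    have h4 : sumY y (i + 1) ≤ sumY y j := partialSum_mono _ hij
    have := sumY_succ y j
    omega
  · have h3 : partialSum x (j + 1) ≤ partialSum x i := partialSum_mono x hij
    have h4 : sumY y (j + 1) ≤ sumY y i := partialSum_mono _ hij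
    have := sumY_succ y i
    have := (y i).pos
    omega

/-- The tree that codes the permutation image of the `(n + 1)`-st block. -/
noncomputable def segmentTree (n : ℕ) : BinaryTree Unit :=
  (imageTree (Nat.succ_pos _) (mem_regBlock_iff x y n) (w (regBlock x y n))).1

@[simp] theorem numNodes_segmentTree (n : ℕ) : (segmentTree x y w n).numNodes = x n :=
  BinaryTree.mem_treesOfNumNodesEq.1
    (imageTree (Nat.succ_pos _) (mem_regBlock_iff x y n) (w (regBlock x y n))).2

theorem treeWord_segmentTree (n : ℕ) :
    treeWord (segmentTree x y w n) (singletonValue x y n + 1) =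
      (w (regBlock x y n)).1.map PNat.val :=
  treeWord_imageTree _ _ _

/-- The first `m` stretches of the regenerative injection. -/
noncomputable def stretches (m : ℕ) : List (ℕ × BinaryTree Unit) :=
  (List.range m).map fun i => ((y i : ℕ) - 1, segmentTree x y w i)

@[simp] theorem length_stretches (m : ℕ) : (stretches x y w m).length = m := by simp [stretches]

theorem stretches_succ (m : ℕ) :
    stretches x y w (m + 1) = stretches x y w m ++ [((y m : ℕ) - 1, segmentTree x y w m)] := by
  simp [stretches, List.range_succ]

theorem beginWord_append (d d' : List (ℕ × BinaryTree Unit)) (a : ℕ) :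
    beginWord (d ++ d') a =
      beginWord d a ++ beginWord d' (a + (d.map fun p => p.1 + 1 + p.2.numNodes).sum) := by
  induction d generalizing a with
  | nil => simp [beginWord]
  | cons p d ih =>
    simp only [List.cons_append, beginWord, ih, List.append_assoc, List.map_cons, List.sum_cons]
    congr 4
    omega

theorem sum_stretches (m : ℕ) :
    ((stretches x y w m).map fun p => p.1 + 1 + p.2.numNodes).sum =
      sumY y m + partialSum x m := by
  induction m with
  | zero => simp [stretches, sumY, partialSum]
  | succ m ih =>
    have := (y m).pos
    rw [stretches_succ, List.map_append, List.sum_append, ih, sumY_succ, partialSum_succ]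
    simp
    omega

/-- The link between the two sides: the stretches write exactly the first `m` segments, with `Y - 1`
letters skipped before each. -/
theorem beginWord_stretches (m : ℕ) :
    beginWord (stretches x y w m) 1 =
      ((List.range m).flatMap (regSegment x y w)).map PNat.val := by
  induction m with
  | zero => simp [stretches, beginWord]
  | succ m ih =>
    have h1 := (y m).pos
    have h2 : 1 + (sumY y m + partialSum x m) + ((y m : ℕ) - 1) = singletonValue x y m := by
      rw [coe_singletonValue, sumY_succ]
      omega
    rw [stretches_succ, beginWord_append, ih, sum_stretches, List.range_succ,
      List.flatMap_append, List.map_append]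
    simp only [beginWord, h2, treeWord_segmentTree, List.flatMap_singleton, regSegment,
      List.map_append]
    rfl

theorem getElem?_flatMap_range {α : Type*} (u : ℕ → List α) (hu : ∀ n, u n ≠ []) {i : ℕ+} {m : ℕ}
    (him : (i : ℕ) ≤ m) : ((List.range m).flatMap u)[(i : ℕ) - 1]? = some (concat u hu i) := by
  obtain ⟨d, rfl⟩ := Nat.exists_eq_add_of_le him
  have h1 := le_length_flatMap_range u hu i
  have h2 := i.pos
  rw [List.range_add, List.flatMap_append, List.getElem?_append_left (by omega),
    List.getElem?_eq_getElem (by omega)]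
  rfl

/-- Every segment is nonempty, so the first `m` segments determine the first `m` positions. -/
theorem beginCylinder_stretches (m : ℕ) :
    beginCylinder m (stretches x y w m) =
      {σ : GenInj | ∀ i : ℕ+, (i : ℕ) ≤ m → σ i = regInjection x y w i} := by
  ext σ
  simp only [beginCylinder, Set.mem_ofPred_eq, beginWord_stretches, List.getElem?_map]
  refine forall_congr' fun i => ⟨fun h him => ?_, fun h v him hv => ?_⟩
  · refine h _ him ?_
    rw [getElem?_flatMap_range _ (regSegment_ne_nil x y w) him]
    rfl
  · rw [h him]
    rw [getElem?_flatMap_range _ (regSegment_ne_nil x y w) him] at hv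
    simp only [Option.map_some, Option.some.injEq] at hv
    rw [← PNat.coe_injective hv]
    rfl

theorem beginWeight_stretches (m : ℕ) :
    beginWeight (stretches x y w m) =
      ∏ i ∈ Finset.range m, (1 / 2 : ℝ) ^ (y i : ℕ) / (2 * 4 ^ x i) := by
  induction m with
  | zero => simp [stretches, beginWeight]
  | succ m ih =>
    have h : (y m : ℕ) - 1 + 1 = y m := Nat.sub_add_cancel (y m).pos
    rw [Finset.prod_range_succ, ← ih, stretches_succ]
    simp only [beginWeight, List.map_append, List.prod_append, List.map_cons, List.map_nil,
      List.prod_singleton, numNodes_segmentTree, h]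

variable {x y w}

theorem stretches_eq_iff {x' : ℕ → ℕ} {y' : ℕ → ℕ+} {w' : (I : Block) → AvoidingImage I} {m : ℕ} :
    stretches x y w m = stretches x' y' w' m ↔
      ∀ i < m, x i = x' i ∧ y i = y' i ∧ w (regBlock x' y' i) = w' (regBlock x' y' i) := by
  -- Singleton and block number `i` depend only on the terms up to `i`, so the images are compared
  -- on the same block.
  have hs : ∀ i, (∀ j ≤ i, x j = x' j ∧ y j = y' j) →
      singletonValue x y i = singletonValue x' y' i ∧ regBlock x y i = regBlock x' y' i := by
    intro i h
    have hx : ∀ n ≤ i + 1, partialSum x n = partialSum x' n := fun n hn =>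
      Finset.sum_congr rfl fun j hj => (h j (by have := Finset.mem_range.1 hj; omega)).1
    have hy : sumY y (i + 1) = sumY y' (i + 1) := by
      change ∑ j ∈ Finset.range (i + 1), (y j : ℕ) = ∑ j ∈ Finset.range (i + 1), (y' j : ℕ)
      refine Finset.sum_congr rfl fun j hj => ?_
      rw [(h j (by have := Finset.mem_range.1 hj; omega)).2]
    have h1 : singletonValue x y i = singletonValue x' y' i := by
      apply PNat.coe_injective
      rw [coe_singletonValue, coe_singletonValue, hx i (by omega), hy]
    have h2 : blockEnd x y i = blockEnd x' y' i := by
      apply PNat.coe_injective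
      rw [coe_blockEnd, coe_blockEnd, hx _ le_rfl, hy]
    exact ⟨h1, Subtype.ext (by simp only [regBlock, h1, h2])⟩
  have hmap : stretches x y w m = stretches x' y' w' m ↔ ∀ i < m,
      ((y i : ℕ) - 1, segmentTree x y w i) = ((y' i : ℕ) - 1, segmentTree x' y' w' i) := by
    simp only [stretches, List.map_inj_left, List.mem_range]
  rw [hmap]
  constructor
  · intro h
    have h1 : ∀ i < m, x i = x' i ∧ y i = y' i := by
      intro i hi
      obtain ⟨ha, hb⟩ := Prod.mk.inj (h i hi)
      refine ⟨?_, PNat.coe_injective ?_⟩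
      · rw [← numNodes_segmentTree x y w, hb, numNodes_segmentTree]
      · have := (y i).pos
        have := (y' i).pos
        change (y i : ℕ) = y' i
        omega
    intro i hi
    refine ⟨(h1 i hi).1, (h1 i hi).2, ?_⟩
    obtain ⟨hsv, hbl⟩ := hs i fun j hj => h1 j (by omega)
    have h3 := treeWord_segmentTree x y w i
    rw [(Prod.mk.inj (h i hi)).2, hsv, treeWord_segmentTree, hbl] at h3
    exact Subtype.ext (List.map_injective_iff.2 PNat.coe_injective h3.symm)
  · intro h i hi
    obtain ⟨hsv, hbl⟩ := hs i fun j hj => ⟨(h j (by omega)).1, (h j (by omega)).2.1⟩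
    rw [(h i hi).2.1, Prod.mk.injEq]
    refine ⟨rfl, treeWord_injective (singletonValue x y i + 1) ?_⟩
    change treeWord _ _ = treeWord _ _
    rw [treeWord_segmentTree, hsv, treeWord_segmentTree, hbl, (h i hi).2.2]

end Stretches

/-! ### Topology of the space of generalised injections -/

theorem GenInj.continuous_apply (i : ℕ+) : Continuous fun σ : GenInj => σ i :=
  (_root_.continuous_apply i).comp continuous_subtype_val

theorem GenInj.exists_cylinder_subset {σ : GenInj} {G : Set GenInj}
    (hG : IsOpen G) (hσG : σ ∈ G) :
    ∃ m : ℕ, {τ : GenInj | ∀ i : ℕ+, (i : ℕ) ≤ m → τ i = σ i} ⊆ G := by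
  obtain ⟨U, hU, rfl⟩ := isOpen_induced_iff.1 hG
  obtain ⟨I, u, hu, hIU⟩ := isOpen_pi_iff.1 hU σ.1 hσG
  refine ⟨I.sup (fun i => (i : ℕ)), fun τ hτ => hIU ?_⟩
  intro i hi
  have h : τ.1 i = σ.1 i := hτ i (Finset.le_sup (f := fun i : ℕ+ => (i : ℕ)) hi)
  rw [h]
  exact (hu i hi).2

/-- The map `k ↦ 1/k`, `∞ ↦ 0` is a continuous injection of a compact space into the line.
Metrizability serves the criterion for weak convergence by open sets and the uniqueness of weak
limits. -/
instance : TopologicalSpace.MetrizableSpace (OnePoint ℕ+) := by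
  let f : OnePoint ℕ+ → ℝ := fun z => z.elim 0 fun k => (k : ℝ)⁻¹
  have hf : Continuous f := by
    rw [OnePoint.continuous_iff_from_discrete]
    change Tendsto (fun k : ℕ+ => ((k : ℕ) : ℝ)⁻¹) cofinite (𝓝 0)
    exact tendsto_inv_atTop_zero.comp (tendsto_natCast_atTop_atTop.comp
      (Nat.cofinite_eq_atTop ▸ PNat.coe_injective.tendsto_cofinite))
  have hinj : Function.Injective f := by
    intro z z' h
    induction z using OnePoint.rec with
    | infty => induction z' using OnePoint.rec with
      | infty => rfl
      | coe k => exact absurd h (inv_pos.2 (Nat.cast_pos.2 k.pos)).ne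
    | coe k => induction z' using OnePoint.rec with
      | infty => exact absurd h (inv_pos.2 (Nat.cast_pos.2 k.pos)).ne'
      | coe k' =>
        simp only [f, OnePoint.elim_some, inv_inj, Nat.cast_inj] at h
        rw [PNat.coe_injective h]
  exact (hf.isClosedEmbedding hinj).isEmbedding.metrizableSpace

instance : TopologicalSpace.MetrizableSpace GenInj := by
  let := TopologicalSpace.metrizableSpaceMetric (OnePoint ℕ+)
  exact (Topology.IsEmbedding.subtypeVal :
    IsEmbedding (Subtype.val : GenInj → ℕ+ → OnePoint ℕ+)).metrizableSpace

theorem GenInj.measurableSet_apply_eq (i : ℕ+) (z : OnePoint ℕ+) :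
    MeasurableSet {σ : GenInj | σ i = z} :=
  (isClosed_singleton.preimage (GenInj.continuous_apply i)).measurableSet

theorem GenInj.measurableSet_injections_diff_permutations :
    MeasurableSet (GenInj.injections \ GenInj.permutations) := by
  have h1 : GenInj.injections = ⋂ i, {σ : GenInj | σ i = OnePoint.infty}ᶜ := by
    ext σ
    simp [GenInj.injections]
  have h2 : GenInj.permutations =
      GenInj.injections ∩ ⋂ k : ℕ+, ⋃ i : ℕ+, {σ : GenInj | σ i = (k : OnePoint ℕ+)} := by
    ext σ
    simp [GenInj.permutations]
  have h3 : MeasurableSet GenInj.injections := by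
    rw [h1]
    exact MeasurableSet.iInter fun i => (GenInj.measurableSet_apply_eq i _).compl
  rw [h2]
  exact h3.diff (h3.inter (MeasurableSet.iInter fun k => MeasurableSet.iUnion fun i =>
    GenInj.measurableSet_apply_eq i _))

/-! ### Values missed by the regenerative injection -/

theorem regInjection_mem_injections (x : ℕ → ℕ) (y : ℕ → ℕ+) (w : (I : Block) → AvoidingImage I) :
    regInjection x y w ∈ GenInj.injections :=
  fun _ => OnePoint.coe_ne_infty _

theorem eq_one_of_regInjection_mem_permutations {x : ℕ → ℕ} {y : ℕ → ℕ+}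
    {w : (I : Block) → AvoidingImage I} (h : regInjection x y w ∈ GenInj.permutations) (n : ℕ) :
    y n = 1 := by
  by_contra hy
  have hy2 : 2 ≤ (y n : ℕ) := by
    have := (y n).pos
    have : (y n : ℕ) ≠ 1 := fun h => hy (PNat.coe_injective h)
    omega
  -- The first value beyond the first `n` segments; segment `n` starts at least one higher when `y n
  -- ≥ 2`.
  obtain ⟨i, hi⟩ := h.2 ⟨sumY y n + partialSum x n + 1, Nat.succ_pos _⟩
  have hi : concat (regSegment x y w) (regSegment_ne_nil x y w) i =
      ⟨sumY y n + partialSum x n + 1, Nat.succ_pos _⟩ := OnePoint.coe_injective hi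
  have hmem : concat (regSegment x y w) (regSegment_ne_nil x y w) i ∈
      (List.range i).flatMap (regSegment x y w) := List.getElem_mem _
  obtain ⟨j, -, hj⟩ := List.mem_flatMap.1 hmem
  obtain ⟨h1, h2⟩ := mem_regSegment hj
  rw [hi, PNat.mk_coe] at h1 h2
  have h5 := sumY_succ y n
  rcases lt_or_ge j n with hjn | hjn
  · have h3 : partialSum x (j + 1) ≤ partialSum x n := partialSum_mono x hjn
    have h4 : sumY y (j + 1) ≤ sumY y n := partialSum_mono _ hjn
    omega
  · have h3 : partialSum x n ≤ partialSum x j := partialSum_mono x hjn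
    have h4 : sumY y (n + 1) ≤ sumY y (j + 1) := partialSum_mono _ (by omega)
    omega

/-! ### Regenerative families -/

/-- Makes lists of stretches countable, so that events can be decomposed by their value. -/
instance : Countable (BinaryTree Unit) := (treeWord_injective 0).countable

namespace IsRegenerativeFamily

variable {Ω : Type*} {X : ℕ → Ω → ℕ} {Y : ℕ → Ω → ℕ+}
  {W : (I : Block) → Ω → AvoidingImage I}

open Classical in
/-- The labels of the random variables that determine the first `m` segments, for given values of
the first two sequences. -/
noncomputable def stretchIndices (x : ℕ → ℕ) (y : ℕ → ℕ+) (m : ℕ) : Finset RVIndex :=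
  (Finset.range m).image .X ∪ ((Finset.range m).image .Y ∪
    (Finset.range m).image fun i => .image (regBlock x y i))

/-- The blocks are random, but once the values of `X` and `Y` are fixed they are deterministic. The
event then concerns finitely many independent variables. -/
theorem setOf_stretches_eq (ω₀ : Ω) (m : ℕ) :
    {ω | stretches (X · ω) (Y · ω) (W · ω) m = stretches (X · ω₀) (Y · ω₀) (W · ω₀) m} =
      ⋂ i ∈ stretchIndices (X · ω₀) (Y · ω₀) m, allRV X Y W i ⁻¹' {allRV X Y W i ω₀} := by
  ext ω
  simp only [Set.mem_ofPred_eq, stretches_eq_iff, stretchIndices, Set.mem_iInter, Finset.mem_union,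
    Finset.mem_image, Finset.mem_range, Set.mem_preimage, Set.mem_singleton_iff]
  constructor
  · rintro h i (⟨n, hn, rfl⟩ | ⟨n, hn, rfl⟩ | ⟨n, hn, rfl⟩)
    · exact (h n hn).1
    · exact (h n hn).2.1
    · exact (h n hn).2.2
  · intro h n hn
    exact ⟨h (.X n) (.inl ⟨n, hn, rfl⟩), h (.Y n) (.inr (.inl ⟨n, hn, rfl⟩)),
      h (.image _) (.inr (.inr ⟨n, hn, rfl⟩))⟩

theorem setOf_regInjection_mem_eq {G : Set GenInj} (hG : IsOpen G) :
    {ω | regInjection (X · ω) (Y · ω) (W · ω) ∈ G} =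
      ⋃ m : ℕ, {ω | beginCylinder m (stretches (X · ω) (Y · ω) (W · ω) m) ⊆ G} := by
  ext ω
  simp only [beginCylinder_stretches, Set.mem_iUnion]
  constructor
  · exact GenInj.exists_cylinder_subset hG
  · rintro ⟨m, hm⟩
    exact hm fun _ _ => rfl

theorem setOf_beginCylinder_subset_eq (G : Set GenInj) (m : ℕ) :
    {ω | beginCylinder m (stretches (X · ω) (Y · ω) (W · ω) m) ⊆ G} =
      ⋃ d : {d : List (ℕ × BinaryTree Unit) // d.length = m ∧ beginCylinder m d ⊆ G},
        {ω | stretches (X · ω) (Y · ω) (W · ω) m = d.1} := by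
  ext ω
  simp only [Set.mem_ofPred_eq, Set.mem_iUnion]
  constructor
  · intro h
    exact ⟨⟨_, length_stretches _ _ _ _, h⟩, rfl⟩
  · rintro ⟨d, hd⟩
    rw [hd]
    exact d.2.2

variable [MeasurableSpace Ω] {P : Measure Ω}

theorem measureReal_iInter_eq_prod (h : IsRegenerativeFamily P X Y W) (S : Finset RVIndex)
    (v : (i : RVIndex) → i.Value) :
    P.real (⋂ i ∈ S, allRV X Y W i ⁻¹' {v i}) = ∏ i ∈ S, P.real (allRV X Y W i ⁻¹' {v i}) := by
  simp only [measureReal_def]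
  rw [h.indep.measure_inter_preimage_eq_mul S (sets := fun i => {v i})
    (fun _ _ => trivial), ENNReal.toReal_prod]

theorem measurableSet_stretches_eq (h : IsRegenerativeFamily P X Y W) (m : ℕ)
    (d : List (ℕ × BinaryTree Unit)) :
    MeasurableSet {ω | stretches (X · ω) (Y · ω) (W · ω) m = d} := by
  by_cases hd : ∃ ω₀, stretches (X · ω₀) (Y · ω₀) (W · ω₀) m = d
  · obtain ⟨ω₀, rfl⟩ := hd
    rw [setOf_stretches_eq]
    exact Finset.measurableSet_biInter _ fun i _ => h.measurable i trivial
  · convert MeasurableSet.empty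
    ext ω
    exact ⟨fun hω => hd ⟨ω, hω⟩, False.elim⟩

/-- If the list is attained, independence gives equality: the Catalan number in the law of `X`
cancels against the uniform law on the images of the block. Otherwise the left side is zero. -/
theorem measureReal_stretches_eq_le (h : IsRegenerativeFamily P X Y W) (m : ℕ)
    (d : List (ℕ × BinaryTree Unit)) :
    P.real {ω | stretches (X · ω) (Y · ω) (W · ω) m = d} ≤ beginWeight d := by
  classical
  by_cases hd : ∃ ω₀, stretches (X · ω₀) (Y · ω₀) (W · ω₀) m = d
  · obtain ⟨ω₀, rfl⟩ := hd
    refine le_of_eq ?_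
    rw [setOf_stretches_eq, h.measureReal_iInter_eq_prod, stretchIndices, Finset.prod_union,
      Finset.prod_union, Finset.prod_image (by simp), Finset.prod_image (by simp),
      Finset.prod_image_of_pairwise_eq_one, beginWeight_stretches, ← Finset.prod_mul_distrib,
      ← Finset.prod_mul_distrib]
    · refine Finset.prod_congr rfl fun i _ => ?_
      have h1 := h.law_X i (X i ω₀)
      have h2 := h.law_Y i (Y i ω₀)
      have h3 := h.law_W (regBlock (X · ω₀) (Y · ω₀) i) (W (regBlock (X · ω₀) (Y · ω₀) i) ω₀)
      rw [card_avoidingImage_regBlock] at h3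
      refine (congrArg₂ (· * ·) h1 (congrArg₂ (· * ·) h2 h3)).trans ?_
      have hc : (catalan (X i ω₀) : ℝ) ≠ 0 := by exact_mod_cast (catalan_pos _).ne'
      field_simp
    -- Segments with the same block share one factor in the product over labels; such a block is
    -- empty, and the factor is `1`.
    · intro i _ j _ hij he
      have he : regBlock (X · ω₀) (Y · ω₀) i = regBlock (X · ω₀) (Y · ω₀) j := by
        simpa using he
      have h0 : X i ω₀ = 0 := regBlock_eq_imp _ _ hij he
      refine (h.law_W (regBlock (X · ω₀) (Y · ω₀) i)
        (W (regBlock (X · ω₀) (Y · ω₀) i) ω₀)).trans ?_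
      rw [card_avoidingImage_regBlock, h0]
      simp
    · simp [Finset.disjoint_left]
    · simp [Finset.disjoint_left]
  · have h0 : {ω | stretches (X · ω) (Y · ω) (W · ω) m = d} = ∅ := by
      ext ω
      exact ⟨fun hω => hd ⟨ω, hω⟩, False.elim⟩
    rw [h0, measureReal_empty]
    exact beginWeight_nonneg d

theorem measurable_regInjection (h : IsRegenerativeFamily P X Y W) :
    Measurable fun ω => regInjection (X · ω) (Y · ω) (W · ω) := by
  refine measurable_of_isOpen fun G hG => ?_
  change MeasurableSet {ω | regInjection (X · ω) (Y · ω) (W · ω) ∈ G}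
  rw [setOf_regInjection_mem_eq hG]
  refine MeasurableSet.iUnion fun m => ?_
  rw [setOf_beginCylinder_subset_eq]
  exact MeasurableSet.iUnion fun d => h.measurableSet_stretches_eq m d.1

/-- The event is exhausted from inside, first by the number `m` of stretches that force membership
in `G`, then by finite sets of lists of length `m`. Each finite stage is bounded by the tree counts.
-/
theorem measure_regInjection_mem_le_liminf [IsProbabilityMeasure P]
    (h : IsRegenerativeFamily P X Y W) {G : Set GenInj} (hG : IsOpen G) :
    P {ω | regInjection (X · ω) (Y · ω) (W · ω) ∈ G} ≤
      liminf (fun n => (mu312 n : Measure GenInj) G) atTop := by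
  have hmono : Monotone fun m : ℕ =>
      {ω | beginCylinder m (stretches (X · ω) (Y · ω) (W · ω) m) ⊆ G} := by
    intro m m' hm ω hω
    simp only [Set.mem_ofPred_eq, beginCylinder_stretches] at hω ⊢
    exact fun σ hσ => hω fun i hi => hσ i (hi.trans hm)
  rw [setOf_regInjection_mem_eq hG, hmono.measure_iUnion]
  refine iSup_le fun m => ?_
  rw [setOf_beginCylinder_subset_eq]
  refine (measure_iUnion_le _).trans ?_
  rw [ENNReal.tsum_eq_iSup_sum]
  refine iSup_le fun A => ?_
  refine le_trans ?_ (sum_beginWeight_le_liminf (m := m) hG.measurableSet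
    (A.map (Function.Embedding.subtype _)) ?_)
  · rw [Finset.sum_map, ENNReal.ofReal_sum_of_nonneg fun d _ => beginWeight_nonneg _]
    refine Finset.sum_le_sum fun d _ => ?_
    rw [← ofReal_measureReal]
    exact ENNReal.ofReal_le_ofReal (h.measureReal_stretches_eq_le m d.1)
  · intro d hd
    obtain ⟨d, -, rfl⟩ := Finset.mem_map.1 hd
    exact d.2

theorem ae_regInjection_mem [IsProbabilityMeasure P] (h : IsRegenerativeFamily P X Y W) :
    ∀ᵐ ω ∂P, regInjection (X · ω) (Y · ω) (W · ω) ∈ GenInj.injections \ GenInj.permutations := by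
  classical
  have hle : ∀ m : ℕ, P.real {ω | ∀ n, Y n ω = 1} ≤ (1 / 2) ^ m := by
    intro m
    -- A point `ω₀` of the event supplies the values required by the product formula, at which all
    -- `Y n` equal `1`.
    rcases Set.eq_empty_or_nonempty {ω | ∀ n, Y n ω = 1} with he | ⟨ω₀, hω₀⟩
    · rw [he, measureReal_empty]
      positivity
    have h1 := h.measureReal_iInter_eq_prod ((Finset.range m).image .Y)
      (fun i => allRV X Y W i ω₀)
    have h2 : ∀ n ∈ Finset.range m,
        P.real (allRV X Y W (.Y n) ⁻¹' {allRV X Y W (.Y n) ω₀}) = 1 / 2 := by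
      intro n _
      refine (h.law_Y n (Y n ω₀)).trans ?_
      rw [hω₀ n]
      simp
    rw [Finset.prod_image (by simp), Finset.prod_congr rfl h2, Finset.prod_const,
      Finset.card_range] at h1
    rw [← h1]
    refine measureReal_mono ?_
    intro ω hω
    simp only [Set.mem_iInter, Finset.mem_image]
    rintro i ⟨n, -, rfl⟩
    exact (hω n).trans (hω₀ n).symm
  have h0 : P.real {ω | ∀ n, Y n ω = 1} = 0 := by
    refine le_antisymm ?_ measureReal_nonneg
    exact ge_of_tendsto' (tendsto_pow_atTop_nhds_zero_of_lt_one (by norm_num) (by norm_num)) hle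
  rw [measureReal_eq_zero_iff] at h0
  refine (measure_eq_zero_iff_ae_notMem.1 h0).mono fun ω hω => ?_
  exact ⟨regInjection_mem_injections _ _ _, fun hp =>
    hω fun n => eq_one_of_regInjection_mem_permutations hp n⟩

theorem tendsto_mu312 [IsProbabilityMeasure P] (h : IsRegenerativeFamily P X Y W) :
    Tendsto mu312 atTop (𝓝 ⟨P.map fun ω => regInjection (X · ω) (Y · ω) (W · ω),
      Measure.isProbabilityMeasure_map h.measurable_regInjection.aemeasurable⟩) := by
  refine tendsto_of_forall_isOpen_le_liminf' fun G hG => ?_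
  rw [ProbabilityMeasure.coe_mk, Measure.map_apply h.measurable_regInjection hG.measurableSet]
  exact h.measure_regInjection_mem_le_liminf hG

end IsRegenerativeFamily

/-! ### Existence of a regenerative family -/

theorem hasSum_one_half_pow_pnat : HasSum (fun k : ℕ+ => (1 / 2 : ℝ) ^ (k : ℕ)) 1 := by
  rw [← Equiv.pnatEquivNat.symm.hasSum_iff]
  have h := hasSum_geometric_two.mul_left (1 / 2)
  rw [one_div_mul_cancel two_ne_zero] at h
  refine h.congr_fun fun n => ?_
  simp [pow_succ, mul_comm]

/-- The probability mass function with given real values. -/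
noncomputable def pmfOfHasSum {α : Type*} {f : α → ℝ} (hf : ∀ a, 0 ≤ f a) (h : HasSum f 1) :
    PMF α :=
  ⟨fun a => ENNReal.ofReal (f a), by
    rw [ENNReal.summable.hasSum_iff, ← ENNReal.ofReal_tsum_of_nonneg hf h.summable, h.tsum_eq,
      ENNReal.ofReal_one]⟩

theorem toReal_pmfOfHasSum {α : Type*} {f : α → ℝ} (hf : ∀ a, 0 ≤ f a) (h : HasSum f 1) (a : α) :
    (pmfOfHasSum hf h a).toReal = f a :=
  ENNReal.toReal_ofReal (hf a)

noncomputable instance (I : Block) : Fintype (AvoidingImage I) := Fintype.ofFinite _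

/-- The law of the random variable with a given label in a regenerative family. -/
noncomputable def regLaw : (i : RVIndex) → PMF i.Value
  | .X _ => pmfOfHasSum (fun _ => by positivity) hasSum_catalan_div
  | .Y _ => pmfOfHasSum (fun _ => by positivity) hasSum_one_half_pow_pnat
  | .image I => PMF.uniformOfFintype (AvoidingImage I)

/-- The law of a regenerative family. -/
noncomputable def regMeasure : Measure ((i : RVIndex) → i.Value) :=
  Measure.infinitePi fun i => (regLaw i).toMeasure

instance : IsProbabilityMeasure regMeasure := by
  unfold regMeasure
  infer_instance

theorem regMeasure_real_eval_eq (i : RVIndex) (v : i.Value) :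
    regMeasure.real {ω | ω i = v} = (regLaw i v).toReal := by
  have hv : MeasurableSet ({v} : Set i.Value) := trivial
  have h := (measurePreserving_eval_infinitePi (fun i => (regLaw i).toMeasure) i).measure_preimage
    hv.nullMeasurableSet
  rw [PMF.toMeasure_apply_singleton _ _ hv] at h
  exact congrArg ENNReal.toReal h

theorem isRegenerativeFamily_regMeasure :
    IsRegenerativeFamily regMeasure (fun n ω => ω (.X n)) (fun n ω => ω (.Y n))
      (fun I ω => ω (.image I)) := by
  have hall : ∀ i, allRV (fun n (ω : (i : RVIndex) → i.Value) => ω (.X n)) (fun n ω => ω (.Y n))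
      (fun I ω => ω (.image I)) i = fun ω => ω i := by
    rintro (n | n | I) <;> rfl
  refine ⟨fun i => ?_, ?_, fun n k => ?_, fun n k => ?_, fun I l => ?_⟩
  · rw [hall]
    exact measurable_pi_apply i
  · rw [funext hall]
    exact iIndepFun_infinitePi (X := fun (i : RVIndex) (v : i.Value) => v) fun i => measurable_id
  · exact (regMeasure_real_eval_eq (.X n) k).trans
      (toReal_pmfOfHasSum (fun _ => by positivity) hasSum_catalan_div k)
  · exact (regMeasure_real_eval_eq (.Y n) k).trans
      (toReal_pmfOfHasSum (fun _ => by positivity) hasSum_one_half_pow_pnat k)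
  · refine (regMeasure_real_eval_eq (.image I) l).trans ?_
    change (PMF.uniformOfFintype (AvoidingImage I) l).toReal = _
    rw [PMF.uniformOfFintype_apply, ENNReal.toReal_inv, ENNReal.toReal_natCast,
      Nat.card_eq_fintype_card, one_div]

theorem theorem312 :
    ∃ ν : ProbabilityMeasure GenInj,
      Tendsto mu312 atTop (𝓝 ν) ∧
      (∀ᵐ σ ∂(ν : Measure GenInj), σ ∈ GenInj.injections \ GenInj.permutations) ∧
      (∃ (Ω : Type) (_ : MeasurableSpace Ω) (P : Measure Ω)
        (X : ℕ → Ω → ℕ) (Y : ℕ → Ω → ℕ+) (W : (I : Block) → Ω → AvoidingImage I),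
        IsProbabilityMeasure P ∧ IsRegenerativeFamily P X Y W) ∧
      ∀ (Ω : Type*) [MeasurableSpace Ω] (P : Measure Ω) [IsProbabilityMeasure P]
        (X : ℕ → Ω → ℕ) (Y : ℕ → Ω → ℕ+) (W : (I : Block) → Ω → AvoidingImage I),
        IsRegenerativeFamily P X Y W →
          Measurable (fun ω => regInjection (X · ω) (Y · ω) (W · ω)) ∧
          (∀ᵐ ω ∂P, regInjection (X · ω) (Y · ω) (W · ω) ∈
            GenInj.injections \ GenInj.permutations) ∧
          P.map (fun ω => regInjection (X · ω) (Y · ω) (W · ω)) = (ν : Measure GenInj) := by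
  refine ⟨_, isRegenerativeFamily_regMeasure.tendsto_mu312, ?_,
    ⟨_, inferInstance, regMeasure, _, _, _, inferInstance, isRegenerativeFamily_regMeasure⟩, ?_⟩
  · exact (ae_map_iff isRegenerativeFamily_regMeasure.measurable_regInjection.aemeasurable
      GenInj.measurableSet_injections_diff_permutations).2
      isRegenerativeFamily_regMeasure.ae_regInjection_mem
  · intro Ω _ P _ X Y W h
    refine ⟨h.measurable_regInjection, h.ae_regInjection_mem, ?_⟩
    -- The law of any regenerative family is a weak limit of `mu312`, hence equals that of the
    -- product construction.
    exact congrArg ProbabilityMeasure.toMeasure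
      (tendsto_nhds_unique h.tendsto_mu312 isRegenerativeFamily_regMeasure.tendsto_mu312)
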